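/- Let $K\ge 1$ users be served by a server that holds $N\ge K$ files over a finite field $\mathbb F_q$, file $W_i$ consisting of $F_i$ independent uniform packets in $\mathbb F_q$. The network is symmetric: every user has a cache of $M\bar F$ packets, where $\bar F=\frac1N\sum_i F_i$ and $0\le M\le N$, and $b=MK/N$ is an integer. The caches are filled by the centralized placement: each file is split into $\binom Kb$ disjoint sub-files of equal size, one for each set $J$ of $b$ users, and user $k$ stores exactly the sub-files with $k\in J$. Then $n$ packets $X_1,\dots,X_n\in\mathbb F_q$ are sent over an erasure broadcast channel, in which each packet is erased at each user with probability $\delta\in[0,1)$, independently across users and slots. For a demand vector $d=(d_1,\dots,d_K)$ with distinct entries, known to server and users, $X_l$ is a function of $W_{d_1},\dots,W_{d_K}$ and of the channel states (the sets of users that receive the packet) of slots $1,\dots,l-1$, and user $k$ estimates $W_{d_k}$ from its channel outputs, its cache and all $n$ channel states. A tuple $(R_1,\dots,R_K)$ of nonnegative rates is achievable if for every $\varepsilon>0$ there are file sizes $F_i$, among which $F_{d_1},\dots,F_{d_K}$ are the sizes of $K$ distinct files, an $n\ge1$ and such a scheme with $R_k<F_{d_k}/n$ for all $k$, in which every user errs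 with probability less than $\varepsilon$, for every vector of distinct demands with these requested file sizes. The rate region is the closure of the set of achievable tuples. (i) The rate region is the set of all $(R_1,\dots,R_K)$ with $R_k\ge0$ for all $k$ and $$\sum_{k=1}^{K-b}\frac{\binom{K-k}{b}/\binom Kb}{1-\delta^k}\,R_{\pi_k}\le 1\qquad\text{for all permutations }\pi\text{ of }\{1,\dots,K\}.$$ (ii) Let all files have the same size $F$, a multiple of $\binom Kb$, and let $T_{\rm tot}(F,\varepsilon)$ be the least number $n$ of slots for which there is such a scheme whose error probability is less than $\varepsilon$ for every user and every vector of distinct demands. Then, for small error probability and as $F\to\infty$, $$T_{\rm tot}=F\left(\sum_{k=1}^{K-b}\frac{\binom{K-k}{b}/\binom Kb}{1-\delta^k}+\epsilon_F\right)$$ with $\epsilon_F$ vanishing; that is, for every $\eta>0$ there is $\varepsilon_0>0$ such that for every $0<\varepsilon<\varepsilon_0$ and all sufficiently large $F$ (divisible by $\binom Kb$), $T_{\rm tot}(F,\varepsilon)$ exists and $$\left|T_{\rm tot}(F,\varepsilon)-F\sum_{k=1}^{K-b}\frac{\binom{K-k}{b}/\binom Kb}{1-\delta^k}\right|\le\eta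 F .$$ -/

import Mathlib

/-- The content of a library of `N` files over the packet alphabet `A`, the `i`-th file having
`Fs i` packets. -/
abbrev Library (A : Type*) {N : ℕ} (Fs : Fin N → ℕ) : Type _ :=
  (i : Fin N) → Fin (Fs i) → A

/-- The channel states of `n` slots with `K` users: in each slot, the set of users that receive
the packet of that slot. -/
abbrev StateSeq (K n : ℕ) : Type := Fin n → Finset (Fin K)

/-- The states of the slots before slot `l`. -/
def pastStates {K n : ℕ} (S : StateSeq K n) (l : Fin n) : StateSeq K l.val :=
  fun j => S (Fin.castLE l.isLt.le j)

/-- Probability of a state sequence: user `k` is erased with probability `δ k`, independently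
across users and slots. -/
noncomputable def stateProb {K n : ℕ} (δ : Fin K → ℝ) (S : StateSeq K n) : ℝ :=
  ∏ l : Fin n, ∏ k : Fin K, if k ∈ S l then 1 - δ k else δ k

/-- A caching scheme for `K` users, `N` files with `Fs i` packets in file `i`, memory of
`M k` times the average file size at user `k`, and `n` channel uses. The caches are filled before
the demand vector `d` is known; encoder and decoders know `d`. In slot `l` the encoder
uses the requested files and the states of the earlier slots; the decoder of user `k` uses
its channel outputs (`none` is an erasure), its cache and the states of all slots. -/
structure CachingScheme (A : Type*) (K N : ℕ) (M : Fin K → ℝ) (Fs : Fin N → ℕ) (n : ℕ) where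
  cacheSize : Fin K → ℕ
  memory : ∀ k, (cacheSize k : ℝ) ≤ M k * ((∑ i, (Fs i : ℝ)) / N)
  cache : (k : Fin K) → Library A Fs → (Fin (cacheSize k) → A)
  enc : (d : Fin K → Fin N) → (l : Fin n) →
    ((k : Fin K) → Fin (Fs (d k)) → A) → StateSeq K l.val → A
  dec : (d : Fin K → Fin N) → (k : Fin K) →
    (Fin n → Option A) → (Fin (cacheSize k) → A) → StateSeq K n → (Fin (Fs (d k)) → A)

namespace CachingScheme

variable {A : Type*} {K N n : ℕ} {M : Fin K → ℝ} {Fs : Fin N → ℕ}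

/-- The channel input in slot `l` when the library is `W` and the state sequence is `S`. -/
def input (C : CachingScheme A K N M Fs n) (d : Fin K → Fin N) (W : Library A Fs)
    (S : StateSeq K n) (l : Fin n) : A :=
  C.enc d l (fun k => W (d k)) (pastStates S l)

/-- The output sequence of user `k`. -/
def output (C : CachingScheme A K N M Fs n) (d : Fin K → Fin N) (W : Library A Fs)
    (S : StateSeq K n) (k : Fin K) : Fin n → Option A :=
  fun l => if k ∈ S l then some (C.input d W S l) else none

/-- What user `k` decodes. -/
def decoded (C : CachingScheme A K N M Fs n) (d : Fin K → Fin N) (W : Library A Fs)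
    (S : StateSeq K n) (k : Fin K) : Fin (Fs (d k)) → A :=
  C.dec d k (C.output d W S k) (C.cache k W) S

open Classical in
/-- The probability that user `k` decodes its requested file wrongly, for independent uniform
files that are independent of the channel states. -/
noncomputable def errorProb [Fintype A] (C : CachingScheme A K N M Fs n) (δ : Fin K → ℝ)
    (d : Fin K → Fin N) (k : Fin K) : ℝ :=
  (∑ W : Library A Fs, ∑ S : StateSeq K n,
    if C.decoded d W S k ≠ W (d k) then stateProb δ S else 0) / Fintype.card (Library A Fs)

/-- The cache contents follow the centralized placement with parameter `b`: the packets of every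
file are partitioned into sub-files of equal size, one for each set `J` of `b` users,
and user `k` stores exactly the packets of the sub-files with `k ∈ J`, uncoded.
Here `place i p` is the set of users that store packet `p` of file `i`. -/
def IsCentralized (C : CachingScheme A K N M Fs n) (b : ℕ) : Prop :=
  ∃ place : (i : Fin N) → Fin (Fs i) → Finset (Fin K),
    (∀ i p, (place i p).card = b) ∧
    (∀ (i : Fin N) (J : Finset (Fin K)), J.card = b →
      K.choose b * (Finset.univ.filter (fun p => place i p = J)).card = Fs i) ∧
    ∀ k : Fin K,
      ∃ e : Fin (C.cacheSize k) ≃ {x : (i : Fin N) × Fin (Fs i) // k ∈ place x.1 x.2},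
        ∀ (W : Library A Fs) (c : Fin (C.cacheSize k)),
          C.cache k W c = W (e c).1.1 (e c).1.2

/-- The error probability of every user is below `ε` for every vector `d` of distinct demands in
which, for all `k`, the file requested by user `k` has `G k` packets. -/
def IsReliable [Fintype A] (C : CachingScheme A K N M Fs n) (δ : Fin K → ℝ) (G : Fin K → ℕ)
    (ε : ℝ) : Prop :=
  ∀ d : Fin K → Fin N, Function.Injective d → (∀ k, Fs (d k) = G k) →
    ∀ k, C.errorProb δ d k < ε

end CachingScheme

/-- The rate tuple `R` is achievable under the centralized placement: for every `ε > 0` there are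
sizes `G k` of the requested files (which are the sizes of `K` distinct files of the library),
a number `n` of slots and a scheme with error probability below `ε` and `R k < G k / n`. -/
def IsAchievable (A : Type*) [Fintype A] (K N : ℕ) (M δ : Fin K → ℝ) (b : ℕ)
    (R : Fin K → ℝ) : Prop :=
  ∀ ε : ℝ, 0 < ε → ∃ (Fs : Fin N → ℕ) (G : Fin K → ℕ) (n : ℕ) (C : CachingScheme A K N M Fs n),
    0 < n ∧ (∃ d : Fin K → Fin N, Function.Injective d ∧ ∀ k, Fs (d k) = G k) ∧
    C.IsCentralized b ∧ C.IsReliable δ G ε ∧ ∀ k, R k < (G k : ℝ) / n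

/-- The rate region under the centralized placement: the closure of the set of achievable
tuples of nonnegative rates. -/
def rateRegion (A : Type*) [Fintype A] (K N : ℕ) (M δ : Fin K → ℝ) (b : ℕ) :
    Set (Fin K → ℝ) :=
  closure {R | (∀ k, 0 ≤ R k) ∧ IsAchievable A K N M δ b R}

/-- The numbers of slots in which, when all files have `F` packets, any `K` distinct requested
files can be delivered with error probability below `ε` under the centralized placement. -/
def deliveryTimes (A : Type*) [Fintype A] (K N : ℕ) (M δ : Fin K → ℝ) (b F : ℕ) (ε : ℝ) :
    Set ℕ :=
  {n | ∃ C : CachingScheme A K N M (fun _ : Fin N => F) n,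
    C.IsCentralized b ∧ C.IsReliable δ (fun _ => F) ε}

/-!
The proof has two halves, a converse and a coding scheme, which meet in the weights
`C(K - k, b) / C(K, b) / (1 - δ ^ k)`.

**Converse.** Fix an order `π` of the users and give the `j`-th user all channel outputs and caches
of its predecessors and their files. The fraction `C(K - j, b) / C(K, b)` of its own file is then
still unknown, and it has to come through a channel that erases a packet with probability `δ ^ j`.
Since the input of a slot does not depend on the state of that slot, what the first `j` users learn
is `1 - δ ^ j` times the information `inputInfo` in the channel inputs relative to what they know
already (`sum_equivocation_sub_obsSetoid`). Conditioning reduces entropy, so that these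
quantities decrease along the order (`inputInfo_mono`), and Fano's inequalities of the users,
divided by `1 - δ ^ j`, telescope to `slots_lower_bound`. Entropies are those of functions of a
uniform library; they are replaced by the sizes of the classes of setoids (`equivocation`), and all
entropy inequalities follow from Gibbs' inequality `equivocation_sub_le`. Fano's inequality is used
with a free parameter instead of the binary entropy, so that it is linear in the error probability
and can be averaged over the channel states.

**Coding scheme.** The packets with number `x` in all sub-files are delivered to the group `U` of
the users whose sub-files are longer than `x`; this replaces any time sharing between the users.
Packets are kept in queues `(U, I)`, whose packets all users of `I` eventually know. A packet wanted
by `k` and cached by `J` starts with `I = (J ∩ U) ∪ {k}`. A slot for the queue `(U, I)` carries a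
random linear combination of its packets; if the users in `s` receive it, the combination is itself
put into the queue `(U, I ∪ (s ∩ U))`. User `k ∈ I` gets an equation on the queue from each slot
that it receives itself, and also from each slot received by somebody in
`U \ I`, because such a combination is in a larger queue, which `k` decodes before
(`eq_of_fullColumnRankOn`). Its unknowns are the packets of the queue that it missed. As a random
linear system is solvable once it has somewhat more equations than unknowns, over any finite field,
Chernoff's bound leaves only the mean values to compare (`exists_coefficients`).

By symmetry the numbers of slots for the queues of a group `U` depend on `|I|` only and satisfy a
triangular linear recursion (`phaseLength`). Its total is computed through the dual recursion, which has the explicit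
solution `deliveryCost` (`sum_choose_mul_phaseLength_le`); Vandermonde's identity adds up the
sub-files of all types. Ordering the users by decreasing rate then turns the total number of slots
into the weighted sum of the theorem (`exists_perm_sum_groupSize_eq`).
-/

/-! ### Channel states -/

/-- Probability that exactly the users in `s` receive a given packet. -/
noncomputable def slotProb {K : ℕ} (δ : ℝ) (s : Finset (Fin K)) : ℝ :=
  ∏ k : Fin K, if k ∈ s then 1 - δ else δ

section States

variable {K n : ℕ} {δ : ℝ}

lemma slotProb_nonneg (h0 : 0 ≤ δ) (h1 : δ < 1) (s : Finset (Fin K)) : 0 ≤ slotProb δ s :=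
  Finset.prod_nonneg fun k _ => by split_ifs <;> linarith

lemma stateProb_eq (S : StateSeq K n) :
    stateProb (fun _ => δ) S = ∏ l, slotProb δ (S l) := rfl

lemma stateProb_nonneg (h0 : 0 ≤ δ) (h1 : δ < 1) (S : StateSeq K n) :
    0 ≤ stateProb (fun _ => δ) S :=
  Finset.prod_nonneg fun l _ => slotProb_nonneg h0 h1 (S l)

lemma sum_prod_ite_mem (f g : Fin K → ℝ) :
    ∑ s : Finset (Fin K), ∏ k, (if k ∈ s then f k else g k) = ∏ k, (f k + g k) := by
  rw [Finset.prod_add, Finset.powerset_univ]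
  refine Finset.sum_congr rfl fun s _ => ?_
  rw [Finset.prod_ite]
  congr 1
  · exact Finset.prod_congr (by ext; simp) fun _ _ => rfl
  · exact Finset.prod_congr (by ext; simp) fun _ _ => rfl

/-- The probability that a packet is received by all users in `B` and by none in `B'`. -/
lemma sum_slotProb_indicator (B B' : Finset (Fin K)) (hB : Disjoint B B') :
    ∑ s : Finset (Fin K), slotProb δ s * (if B ⊆ s ∧ Disjoint s B' then 1 else 0) =
      (1 - δ) ^ B.card * δ ^ B'.card := by
  have h : ∀ s : Finset (Fin K), slotProb δ s * (if B ⊆ s ∧ Disjoint s B' then 1 else 0) =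
      ∏ k, if k ∈ s then (if k ∈ B' then 0 else 1 - δ) else (if k ∈ B then 0 else δ) := by
    intro s
    split_ifs with hs
    · rw [mul_one]
      refine Finset.prod_congr rfl fun k _ => ?_
      split_ifs with h1 h2 h2
      · exact absurd h2 (Finset.disjoint_left.1 hs.2 h1)
      · rfl
      · exact absurd (hs.1 h2) h1
      · rfl
    · rw [mul_zero, eq_comm]
      rw [not_and_or, Finset.not_subset, Finset.not_disjoint_iff] at hs
      obtain ⟨k, hk⟩ : ∃ k, (k ∈ B ∧ k ∉ s) ∨ (k ∈ s ∧ k ∈ B') := by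
        rcases hs with ⟨k, hk⟩ | ⟨k, hk⟩
        exacts [⟨k, Or.inl hk⟩, ⟨k, Or.inr hk⟩]
      refine Finset.prod_eq_zero (Finset.mem_univ k) ?_
      rcases hk with hk | hk <;> simp [hk.1, hk.2]
  rw [Finset.sum_congr rfl fun s _ => h s, sum_prod_ite_mem]
  have h2 : ∀ k, ((if k ∈ B' then 0 else 1 - δ) + (if k ∈ B then 0 else δ) : ℝ) =
      (if k ∈ B then 1 - δ else 1) * (if k ∈ B' then δ else 1) := by
    intro k
    by_cases hk : k ∈ B
    · simp [hk, Finset.disjoint_left.1 hB hk]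
    · by_cases hk' : k ∈ B' <;> simp [hk, hk']
  rw [Finset.prod_congr rfl fun k _ => h2 k, Finset.prod_mul_distrib]
  simp [Finset.prod_ite_mem]

lemma sum_slotProb : ∑ s : Finset (Fin K), slotProb δ s = 1 := by
  simpa using sum_slotProb_indicator (δ := δ) (∅ : Finset (Fin K)) ∅ (by simp)

/-- The probability that a packet is received by some user in `B`. -/
lemma sum_slotProb_nonempty (B : Finset (Fin K)) :
    ∑ s : Finset (Fin K), slotProb δ s * (if (s ∩ B).Nonempty then 1 else 0) =
      1 - δ ^ B.card := by
  have h := sum_slotProb_indicator (δ := δ) ∅ B (by simp)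
  simp only [Finset.empty_subset, true_and, Finset.card_empty, pow_zero, one_mul] at h
  rw [← h, eq_sub_iff_add_eq, ← Finset.sum_add_distrib]
  refine (Finset.sum_congr rfl fun s _ => ?_).trans (sum_slotProb (K := K) (δ := δ))
  by_cases hs : Disjoint s B
  · simp [hs, Finset.disjoint_iff_inter_eq_empty.1 hs]
  · rw [if_pos (Finset.not_disjoint_iff_nonempty_inter.1 hs)]
    simp [hs]

/-- The expectation of a product of functions of the states of single slots. -/
lemma sum_stateProb_mul_prod (g : Fin n → Finset (Fin K) → ℝ) :
    ∑ S : StateSeq K n, stateProb (fun _ => δ) S * ∏ l, g l (S l) =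
      ∏ l, ∑ s, slotProb δ s * g l s := by
  rw [Finset.prod_univ_sum, Fintype.piFinset_univ]
  refine Finset.sum_congr rfl fun S _ => ?_
  rw [stateProb_eq, ← Finset.prod_mul_distrib]

lemma sum_stateProb : ∑ S : StateSeq K n, stateProb (fun _ => δ) S = 1 := by
  simpa [sum_slotProb] using sum_stateProb_mul_prod (K := K) (n := n) (δ := δ) fun _ _ => 1

/-- The state of slot `l` is independent of the states of the other slots. -/
lemma sum_stateProb_mul_indep (l : Fin n) (φ : StateSeq K n → ℝ) (g : Finset (Fin K) → ℝ)
    (hφ : ∀ S s, φ (Function.update S l s) = φ S) :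
    ∑ S : StateSeq K n, stateProb (fun _ => δ) S * (g (S l) * φ S) =
      (∑ s, slotProb δ s * g s) * ∑ S : StateSeq K n, stateProb (fun _ => δ) S * φ S := by
  -- Resampling the state of slot `l` is a measure-preserving involution.
  have hu : ∀ (S : StateSeq K n) (s : Finset (Fin K)),
      stateProb (fun _ => δ) (Function.update S l s) * slotProb δ (S l) =
        stateProb (fun _ => δ) S * slotProb δ s := by
    intro S s
    rw [stateProb_eq, stateProb_eq, ← Finset.mul_prod_erase _ _ (Finset.mem_univ l),
      ← Finset.mul_prod_erase _ (fun j => slotProb δ (S j)) (Finset.mem_univ l),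
      Function.update_self]
    rw [Finset.prod_congr rfl fun j hj => by
      rw [Function.update_of_ne (Finset.ne_of_mem_erase hj)]]
    ring
  let σ : StateSeq K n × Finset (Fin K) → StateSeq K n × Finset (Fin K) :=
    fun x => (Function.update x.1 l x.2, x.1 l)
  have hσ : Function.Involutive σ := fun x => by simp [σ]
  calc ∑ S : StateSeq K n, stateProb (fun _ => δ) S * (g (S l) * φ S)
      = ∑ x : StateSeq K n × Finset (Fin K),
          stateProb (fun _ => δ) x.1 * slotProb δ x.2 * (g (x.1 l) * φ x.1) := by
        rw [Fintype.sum_prod_type]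
        refine Finset.sum_congr rfl fun S _ => ?_
        simp_rw [mul_right_comm _ (slotProb δ _), ← Finset.mul_sum, sum_slotProb, mul_one]
    _ = ∑ x : StateSeq K n × Finset (Fin K),
          stateProb (fun _ => δ) x.1 * slotProb δ x.2 * (g x.2 * φ x.1) := by
        refine Fintype.sum_equiv hσ.toPerm _ _ fun x => ?_
        simp only [Function.Involutive.coe_toPerm, σ, hφ, hu]
    _ = _ := by
        rw [Fintype.sum_prod_type, Finset.mul_sum]
        refine Finset.sum_congr rfl fun S _ => ?_
        rw [Finset.sum_mul]
        exact Finset.sum_congr rfl fun s _ => by ring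

end States

/-! ### Equivocation of a partition -/

open Classical in
/-- The size of the class of `w` under the equivalence relation `r`. -/
noncomputable def cellCard {Ω : Type*} [Fintype Ω] (r : Setoid Ω) (w : Ω) : ℕ :=
  (Finset.univ.filter fun w' => r w w').card

/-- The total equivocation of `r`: for a uniform `w`, the conditional entropy of `w` given its
`r`-class, in nats, multiplied by the number of points. Setoids stand for observations: two points
are related if the observation does not tell them apart, and `⊓` joins two observations. -/
noncomputable def equivocation {Ω : Type*} [Fintype Ω] (r : Setoid Ω) : ℝ :=
  ∑ w, Real.log (cellCard r w)

section Equivocation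

open Classical

variable {Ω : Type*} [Fintype Ω]

lemma cellCard_pos (r : Setoid Ω) (w : Ω) : 0 < cellCard r w :=
  Finset.card_pos.2 ⟨w, by simp⟩

lemma cellCard_congr {r : Setoid Ω} {w w' : Ω} (h : r w w') : cellCard r w = cellCard r w' := by
  unfold cellCard
  congr 1
  ext x
  simp only [Finset.mem_filter, Finset.mem_univ, true_and]
  exact ⟨fun hx => r.trans' (r.symm' h) hx, fun hx => r.trans' h hx⟩

lemma cellCard_mono {r s : Setoid Ω} (h : r ≤ s) (w : Ω) : cellCard r w ≤ cellCard s w :=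
  Finset.card_le_card (Finset.monotone_filter_right _ fun _ _ hx => h hx)

lemma equivocation_mono {r s : Setoid Ω} (h : r ≤ s) : equivocation r ≤ equivocation s :=
  Finset.sum_le_sum fun w _ => Real.log_le_log (by exact_mod_cast cellCard_pos r w)
    (by exact_mod_cast cellCard_mono h w)

lemma sum_inv_cellCard_le_one (s : Setoid Ω) (C : Finset Ω) (h : ∀ x ∈ C, ∀ y ∈ C, s x y) :
    ∑ x ∈ C, (1 : ℝ) / cellCard s x ≤ 1 := by
  rcases C.eq_empty_or_nonempty with rfl | hC
  · simp
  have hc : (0 : ℝ) < C.card := by exact_mod_cast hC.card_pos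
  calc ∑ x ∈ C, (1 : ℝ) / cellCard s x ≤ ∑ x ∈ C, (1 : ℝ) / C.card := by
        refine Finset.sum_le_sum fun x hx => one_div_le_one_div_of_le hc ?_
        exact_mod_cast Finset.card_le_card fun y hy => by simpa using h x hx y hy
    _ = 1 := by simp [hc.ne']

/-- Gibbs' inequality: a refinement `s` of `r` lowers the equivocation by at most the
cross-entropy of any assignment `Q` of subprobabilities to the `s`-classes inside the
`r`-classes. -/
lemma equivocation_sub_le {r s : Setoid Ω} (Q : Ω → ℝ) (hQ : ∀ w, 0 < Q w)
    (h : ∀ w, ∑ w' ∈ Finset.univ.filter (fun w' => r w w'), Q w' / cellCard s w' ≤ 1) :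
    equivocation r - equivocation s ≤ ∑ w, -Real.log (Q w) := by
  have hp : ∀ (r : Setoid Ω) (w : Ω), (0 : ℝ) < cellCard r w :=
    fun r w => by exact_mod_cast cellCard_pos r w
  have h1 : ∀ w, Real.log (cellCard r w) - Real.log (cellCard s w) + Real.log (Q w) ≤
      cellCard r w * (Q w / cellCard s w) - 1 := by
    intro w
    rw [← Real.log_div (hp r w).ne' (hp s w).ne', ← Real.log_mul (div_pos (hp r w) (hp s w)).ne'
      (hQ w).ne']
    refine (Real.log_le_sub_one_of_pos (mul_pos (div_pos (hp r w) (hp s w)) (hQ w))).trans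
      (le_of_eq ?_)
    ring
  have h2 : ∑ w, (cellCard r w : ℝ) * (Q w / cellCard s w) ≤ Fintype.card Ω := by
    calc ∑ w, (cellCard r w : ℝ) * (Q w / cellCard s w)
        = ∑ w, ∑ w', if r w w' then Q w / cellCard s w else 0 := by
          refine Finset.sum_congr rfl fun w _ => ?_
          rw [← Finset.sum_filter, Finset.sum_const, nsmul_eq_mul]
          rfl
      _ = ∑ w', ∑ w, if r w' w then Q w / cellCard s w else 0 := by
          rw [Finset.sum_comm]
          simp_rw [r.comm']
      _ ≤ ∑ w' : Ω, (1 : ℝ) := by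
          refine Finset.sum_le_sum fun w _ => ?_
          rw [← Finset.sum_filter]
          exact h w
      _ = Fintype.card Ω := by simp
  have h3 := Finset.sum_le_sum fun w (_ : w ∈ Finset.univ) => h1 w
  rw [Finset.sum_add_distrib, Finset.sum_sub_distrib, Finset.sum_sub_distrib] at h3
  rw [Finset.sum_neg_distrib]
  simp only [Finset.sum_const, Finset.card_univ, nsmul_eq_mul, mul_one] at h3
  unfold equivocation
  linarith

lemma sum_cell_div_le {B : Type*} [Fintype B] (r : Setoid Ω) (f : Ω → B) (φ : B → ℝ)
    (hφ : ∀ b, 0 ≤ φ b) (w : Ω) :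
    ∑ w' ∈ Finset.univ.filter (fun w' => r w w'), φ (f w') / cellCard (r ⊓ Setoid.ker f) w' ≤
      ∑ b, φ b := by
  rw [← Finset.sum_fiberwise (s := Finset.univ.filter fun w' => r w w') (g := f)]
  refine Finset.sum_le_sum fun b _ => ?_
  calc ∑ w' ∈ (Finset.univ.filter fun w' => r w w').filter (fun w' => f w' = b),
        φ (f w') / cellCard (r ⊓ Setoid.ker f) w'
      = φ b * ∑ w' ∈ (Finset.univ.filter fun w' => r w w').filter (fun w' => f w' = b),
        (1 : ℝ) / cellCard (r ⊓ Setoid.ker f) w' := by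
        rw [Finset.mul_sum]
        refine Finset.sum_congr rfl fun x hx => ?_
        rw [(Finset.mem_filter.1 hx).2]
        ring
    _ ≤ φ b * 1 := by
        refine mul_le_mul_of_nonneg_left (sum_inv_cellCard_le_one _ _ ?_) (hφ b)
        intro x hx y hy
        simp only [Finset.mem_filter, Finset.mem_univ, true_and] at hx hy
        exact ⟨r.trans' (r.symm' hx.1) hy.1, hx.2.trans hy.2.symm⟩
    _ = φ b := mul_one _

/-- An observation with values in `B` lowers the equivocation by at most `log |B|` per point. -/
lemma equivocation_sub_ker_le {B : Type*} [Fintype B] [Nonempty B] (r : Setoid Ω) (f : Ω → B) :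
    equivocation r - equivocation (r ⊓ Setoid.ker f) ≤
      Fintype.card Ω * Real.log (Fintype.card B) := by
  have hB : (0 : ℝ) < Fintype.card B := by exact_mod_cast Fintype.card_pos
  refine (equivocation_sub_le (fun _ => 1 / (Fintype.card B : ℝ)) (fun _ => by positivity)
    fun w => ?_).trans (le_of_eq ?_)
  · refine (sum_cell_div_le r f (fun _ => 1 / (Fintype.card B : ℝ)) (fun _ => by positivity)
      w).trans (le_of_eq ?_)
    simp [hB.ne']
  · simp

/-- Fano's inequality, in a form that is linear in the number of errors: `t` is a free parameter
in place of the error probability. -/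
lemma equivocation_sub_ker_le_of_estimate {B : Type*} [Fintype B] (r : Setoid Ω) (f g : Ω → B)
    (hg : ∀ w w', r w w' → g w = g w') {t : ℝ} (t0 : 0 < t) (t1 : t < 1) :
    equivocation r - equivocation (r ⊓ Setoid.ker f) ≤
      ∑ w, (-Real.log (1 - t) +
        if g w ≠ f w then Real.log (Fintype.card B) - Real.log t else 0) := by
  rcases isEmpty_or_nonempty Ω with hΩ | ⟨⟨w₀⟩⟩
  · simp [equivocation]
  have : Nonempty B := ⟨f w₀⟩
  have hB : (0 : ℝ) < Fintype.card B := by exact_mod_cast Fintype.card_pos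
  have ht : 0 < 1 - t := by linarith
  have htB : 0 < t / Fintype.card B := by positivity
  obtain ⟨φ, hφ⟩ : ∃ φ : B → B → ℝ,
      ∀ a b, φ a b = (if a = b then 1 - t else 0) + t / Fintype.card B := ⟨_, fun _ _ => rfl⟩
  have hpos : ∀ a b : B, 0 < φ a b := by
    intro a b
    rw [hφ]
    split_ifs <;> linarith
  have hsum : ∀ a : B, ∑ b, φ a b = 1 := by
    intro a
    simp_rw [hφ]
    rw [Finset.sum_add_distrib, Finset.sum_ite_eq, if_pos (Finset.mem_univ a), Finset.sum_const,
      Finset.card_univ, nsmul_eq_mul, mul_div_cancel₀ _ hB.ne']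
    ring
  refine (equivocation_sub_le (fun w => φ (g w) (f w)) (fun w => hpos _ _) fun w => ?_).trans
    (Finset.sum_le_sum fun w _ => ?_)
  · refine le_trans (le_of_eq ?_)
      ((sum_cell_div_le r f (φ (g w)) (fun b => (hpos _ _).le) w).trans (hsum _).le)
    refine Finset.sum_congr rfl fun x hx => ?_
    rw [hg w x (Finset.mem_filter.1 hx).2]
  · have h1 : Real.log (1 - t) ≤ 0 := Real.log_nonpos ht.le (by linarith)
    rw [hφ]
    by_cases hw : g w = f w
    · simp only [hw, if_true, ne_eq, not_true_eq_false, if_false, add_zero]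
      exact neg_le_neg (Real.log_le_log ht (by linarith))
    · simp only [hw, if_false, ne_eq, not_false_eq_true, if_true, zero_add]
      rw [Real.log_div t0.ne' hB.ne']
      linarith

/-- Conditioning reduces entropy: an observation `s` reveals less to an observer who already
knows more. -/
lemma equivocation_sub_inf_mono {r' r : Setoid Ω} (h : r' ≤ r) (s : Setoid Ω) :
    equivocation r' - equivocation (r' ⊓ s) ≤ equivocation r - equivocation (r ⊓ s) := by
  have hp : ∀ (r : Setoid Ω) (w : Ω), (0 : ℝ) < cellCard r w :=
    fun r w => by exact_mod_cast cellCard_pos r w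
  refine (equivocation_sub_le (fun w => (cellCard (r ⊓ s) w : ℝ) / cellCard r w)
    (fun w => div_pos (hp _ _) (hp _ _)) fun w => ?_).trans (le_of_eq ?_)
  · calc ∑ w' ∈ Finset.univ.filter (fun w' => r' w w'),
          (cellCard (r ⊓ s) w' : ℝ) / cellCard r w' / cellCard (r' ⊓ s) w'
        = (1 / cellCard r w) * ∑ w' ∈ Finset.univ.filter (fun w' => r' w w'),
            ∑ x ∈ Finset.univ.filter (fun x => r w x),
              if (r ⊓ s) w' x then (1 : ℝ) / cellCard (r' ⊓ s) w' else 0 := by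
          rw [Finset.mul_sum]
          refine Finset.sum_congr rfl fun w' hw' => ?_
          have hr : r w w' := h (Finset.mem_filter.1 hw').2
          rw [← Finset.sum_filter, Finset.sum_const, nsmul_eq_mul, cellCard_congr hr]
          have : (Finset.univ.filter fun x => r w x).filter (fun x => (r ⊓ s) w' x) =
              Finset.univ.filter fun x => (r ⊓ s) w' x := by
            ext x
            simp only [Finset.mem_filter, Finset.mem_univ, true_and, and_iff_right_iff_imp]
            exact fun hx => r.trans' hr hx.1
          rw [this]
          unfold cellCard
          ring
      _ ≤ (1 / cellCard r w) * ∑ x ∈ Finset.univ.filter (fun x => r w x), (1 : ℝ) := by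
          refine mul_le_mul_of_nonneg_left ?_ (by positivity)
          rw [Finset.sum_comm]
          refine Finset.sum_le_sum fun x _ => ?_
          rw [← Finset.sum_filter]
          refine sum_inv_cellCard_le_one _ _ fun y hy z hz => ?_
          simp only [Finset.mem_filter, Finset.mem_univ, true_and] at hy hz
          exact ⟨r'.trans' (r'.symm' hy.1) hz.1, s.trans' hy.2.2 (s.symm' hz.2.2)⟩
      _ = 1 := by
          rw [Finset.sum_const, nsmul_eq_mul, mul_one]
          exact one_div_mul_cancel (hp r w).ne'
  · rw [equivocation, equivocation, ← Finset.sum_sub_distrib]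
    refine Finset.sum_congr rfl fun w _ => ?_
    rw [Real.log_div (hp _ _).ne' (hp _ _).ne']
    ring

end Equivocation

/-! ### Information delivered by a scheme -/

section Converse

variable {A : Type*} {K N n : ℕ} {M : Fin K → ℝ} {Fs : Fin N → ℕ} {δ : ℝ}

/-- What the users in `I` jointly learn from the channel before slot `l`: two libraries are related
if they lead to the same inputs in all slots before `l` in which some user of `I` receives. -/
def obsSetoid (C : CachingScheme A K N M Fs n) (d : Fin K → Fin N) (S : StateSeq K n)
    (I : Finset (Fin K)) (l : ℕ) : Setoid (Library A Fs) where
  r W W' := ∀ j : Fin n, j.val < l → (S j ∩ I).Nonempty → C.input d W S j = C.input d W' S j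
  iseqv := ⟨fun _ _ _ _ => rfl, fun h _ hj hS => (h _ hj hS).symm,
    fun h h' j hj hS => (h j hj hS).trans (h' j hj hS)⟩

/-- The expected information in the channel inputs, summed over the slots, for an observer who
knows `U` and all that the users in `I` received earlier. -/
noncomputable def inputInfo [Fintype A] (C : CachingScheme A K N M Fs n) (δ : ℝ)
    (d : Fin K → Fin N) (U : Setoid (Library A Fs)) (I : Finset (Fin K)) : ℝ :=
  ∑ l : Fin n, ∑ S : StateSeq K n, stateProb (fun _ => δ) S *
    (equivocation (U ⊓ obsSetoid C d S I l) -
      equivocation (U ⊓ obsSetoid C d S I l ⊓ Setoid.ker fun W => C.input d W S l))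

lemma input_update (C : CachingScheme A K N M Fs n) (d : Fin K → Fin N) (W : Library A Fs)
    (S : StateSeq K n) {l j : Fin n} (hj : j ≤ l) (s : Finset (Fin K)) :
    C.input d W (Function.update S l s) j = C.input d W S j := by
  unfold CachingScheme.input
  congr 1
  funext i
  unfold pastStates
  refine Function.update_of_ne (Fin.ne_of_lt ?_) _ _
  exact lt_of_lt_of_le (by exact i.isLt) hj

lemma obsSetoid_update (C : CachingScheme A K N M Fs n) (d : Fin K → Fin N) (S : StateSeq K n)
    (I : Finset (Fin K)) (l : Fin n) (s : Finset (Fin K)) :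
    obsSetoid C d (Function.update S l s) I l = obsSetoid C d S I l := by
  ext W W'
  refine forall_congr' fun j => forall_congr' fun hj => ?_
  have hjl : j < l := hj
  rw [Function.update_of_ne hjl.ne, input_update C d W S hjl.le, input_update C d W' S hjl.le]

lemma obsSetoid_zero (C : CachingScheme A K N M Fs n) (d : Fin K → Fin N) (S : StateSeq K n)
    (I : Finset (Fin K)) : obsSetoid C d S I 0 = ⊤ :=
  top_unique fun _ _ _ _ hj => absurd hj (Nat.not_lt_zero _)

lemma obsSetoid_succ (C : CachingScheme A K N M Fs n) (d : Fin K → Fin N) (S : StateSeq K n)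
    (I : Finset (Fin K)) (l : Fin n) :
    obsSetoid C d S I (l.val + 1) = if (S l ∩ I).Nonempty then
      obsSetoid C d S I l ⊓ Setoid.ker (fun W => C.input d W S l) else obsSetoid C d S I l := by
  split_ifs with h
  · ext W W'
    refine ⟨fun hW => ⟨fun j hj hS => hW j (hj.trans (Nat.lt_succ_self _)) hS,
      hW l (Nat.lt_succ_self _) h⟩, fun hW j hj hS => ?_⟩
    rcases Nat.lt_succ_iff_lt_or_eq.1 hj with hj | hj
    · exact hW.1 j hj hS
    · obtain rfl := Fin.ext hj
      exact hW.2
  · ext W W'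
    refine ⟨fun hW j hj hS => hW j (hj.trans (Nat.lt_succ_self _)) hS, fun hW j hj hS => ?_⟩
    rcases Nat.lt_succ_iff_lt_or_eq.1 hj with hj | hj
    · exact hW j hj hS
    · obtain rfl := Fin.ext hj
      exact absurd hS h

variable [Fintype A]

lemma equivocation_sub_obsSetoid (C : CachingScheme A K N M Fs n) (d : Fin K → Fin N)
    (S : StateSeq K n) (U : Setoid (Library A Fs)) (I : Finset (Fin K)) :
    equivocation U - equivocation (U ⊓ obsSetoid C d S I n) =
      ∑ l : Fin n, (if (S l ∩ I).Nonempty then 1 else 0) *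
        (equivocation (U ⊓ obsSetoid C d S I l) -
          equivocation (U ⊓ obsSetoid C d S I l ⊓ Setoid.ker fun W => C.input d W S l)) := by
  have h := Finset.sum_range_sub' (fun l => equivocation (U ⊓ obsSetoid C d S I l)) n
  rw [obsSetoid_zero, inf_top_eq, ← Fin.sum_univ_eq_sum_range
    (fun l => equivocation (U ⊓ obsSetoid C d S I l) -
      equivocation (U ⊓ obsSetoid C d S I (l + 1)))] at h
  rw [← h]
  refine Finset.sum_congr rfl fun l _ => ?_
  rw [obsSetoid_succ]
  split_ifs with hS
  · rw [one_mul, inf_assoc]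
  · rw [zero_mul, sub_self]

/-- What the users in `I` learn in the whole transmission, through the `1 - δ ^ |I|` of the slots
in which at least one of them receives: the input of a slot does not depend on the state of that
slot. -/
lemma sum_equivocation_sub_obsSetoid (C : CachingScheme A K N M Fs n) (d : Fin K → Fin N)
    (U : Setoid (Library A Fs)) (I : Finset (Fin K)) :
    ∑ S : StateSeq K n, stateProb (fun _ => δ) S *
        (equivocation U - equivocation (U ⊓ obsSetoid C d S I n)) =
      (1 - δ ^ I.card) * inputInfo C δ d U I := by
  simp_rw [equivocation_sub_obsSetoid, Finset.mul_sum]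
  rw [Finset.sum_comm, inputInfo, Finset.mul_sum]
  refine Finset.sum_congr rfl fun l _ => ?_
  rw [← sum_slotProb_nonempty]
  refine sum_stateProb_mul_indep l (fun S => equivocation (U ⊓ obsSetoid C d S I l) -
    equivocation (U ⊓ obsSetoid C d S I l ⊓ Setoid.ker fun W => C.input d W S l))
    (fun s => if (s ∩ I).Nonempty then 1 else 0) fun S s => ?_
  simp only [obsSetoid_update, input_update C d _ S le_rfl]

lemma inputInfo_mono (h0 : 0 ≤ δ) (h1 : δ < 1) (C : CachingScheme A K N M Fs n)
    (d : Fin K → Fin N) {U U' : Setoid (Library A Fs)} {I I' : Finset (Fin K)} (hU : U' ≤ U)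
    (hI : I ⊆ I') : inputInfo C δ d U' I' ≤ inputInfo C δ d U I := by
  refine Finset.sum_le_sum fun l _ => Finset.sum_le_sum fun S _ =>
    mul_le_mul_of_nonneg_left ?_ (stateProb_nonneg h0 h1 S)
  have hobs : obsSetoid C d S I' l ≤ obsSetoid C d S I l := fun W W' h j hj hS =>
    h j hj (hS.mono (Finset.inter_subset_inter_left hI))
  exact equivocation_sub_inf_mono (inf_le_inf hU hobs) _

lemma inputInfo_nonneg (h0 : 0 ≤ δ) (h1 : δ < 1) (C : CachingScheme A K N M Fs n)
    (d : Fin K → Fin N) (U : Setoid (Library A Fs)) (I : Finset (Fin K)) :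
    0 ≤ inputInfo C δ d U I :=
  Finset.sum_nonneg fun _ _ => Finset.sum_nonneg fun S _ =>
    mul_nonneg (stateProb_nonneg h0 h1 S) (sub_nonneg.2 (equivocation_mono inf_le_left))

lemma inputInfo_le [Nonempty A] (h0 : 0 ≤ δ) (h1 : δ < 1) (C : CachingScheme A K N M Fs n)
    (d : Fin K → Fin N) (U : Setoid (Library A Fs)) (I : Finset (Fin K)) :
    inputInfo C δ d U I ≤ n * (Fintype.card (Library A Fs) * Real.log (Fintype.card A)) := by
  calc inputInfo C δ d U I
      ≤ ∑ l : Fin n, ∑ S : StateSeq K n, stateProb (fun _ => δ) S *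
          (Fintype.card (Library A Fs) * Real.log (Fintype.card A)) :=
        Finset.sum_le_sum fun l _ => Finset.sum_le_sum fun S _ =>
          mul_le_mul_of_nonneg_left (equivocation_sub_ker_le _ _) (stateProb_nonneg h0 h1 S)
    _ = _ := by
        simp [← Finset.sum_mul, sum_stateProb]

/-- A user `k` that knows `U` and decodes its file from what the users in `I` receive: the part of
the file that `U` does not reveal has to be delivered over the channel, up to Fano's loss. -/
lemma file_info_le_inputInfo [Nonempty A] (h0 : 0 ≤ δ) (h1 : δ < 1)
    (C : CachingScheme A K N M Fs n) (d : Fin K → Fin N) (k : Fin K) (I : Finset (Fin K))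
    (hk : k ∈ I) (U : Setoid (Library A Fs)) (hU : ∀ W W', U W W' → C.cache k W = C.cache k W')
    {t : ℝ} (t0 : 0 < t) (t1 : t < 1) :
    equivocation U - equivocation (U ⊓ Setoid.ker fun W => W (d k)) -
        Fintype.card (Library A Fs) * (-Real.log (1 - t) + C.errorProb (fun _ => δ) d k *
          (Fs (d k) * Real.log (Fintype.card A) - Real.log t)) ≤
      (1 - δ ^ I.card) * (inputInfo C δ d U I -
        inputInfo C δ d (U ⊓ Setoid.ker fun W => W (d k)) I) := by
  classical
  have hfano : ∀ S : StateSeq K n,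
      equivocation (U ⊓ obsSetoid C d S I n) -
        equivocation (U ⊓ obsSetoid C d S I n ⊓ Setoid.ker fun W => W (d k)) ≤
      ∑ W : Library A Fs, (-Real.log (1 - t) + if C.decoded d W S k ≠ W (d k) then
        (Fs (d k) * Real.log (Fintype.card A) - Real.log t) else 0) := by
    intro S
    refine (equivocation_sub_ker_le_of_estimate _ _ (fun W => C.decoded d W S k)
      (fun W W' hW => ?_) t0 t1).trans (le_of_eq ?_)
    · have : C.output d W S k = C.output d W' S k := by
        funext l
        unfold CachingScheme.output
        split_ifs with hl
        · rw [hW.2 l l.isLt ⟨k, Finset.mem_inter.2 ⟨hl, hk⟩⟩]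
        · rfl
      unfold CachingScheme.decoded
      rw [this, hU W W' hW.1]
    · refine Finset.sum_congr rfl fun W _ => ?_
      rw [Fintype.card_fun, Fintype.card_fin, Nat.cast_pow, Real.log_pow]
      congr 1
      split_ifs <;> rfl
  have hsum := Finset.sum_le_sum fun S (_ : S ∈ Finset.univ) =>
    mul_le_mul_of_nonneg_left (hfano S) (stateProb_nonneg h0 h1 S)
  have hΩ : (Fintype.card (Library A Fs) : ℝ) ≠ 0 := by
    exact_mod_cast Fintype.card_ne_zero
  have herr : ∑ S : StateSeq K n, stateProb (fun _ => δ) S *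
      ∑ W : Library A Fs, (-Real.log (1 - t) + if C.decoded d W S k ≠ W (d k) then
        (Fs (d k) * Real.log (Fintype.card A) - Real.log t) else 0) =
      Fintype.card (Library A Fs) * (-Real.log (1 - t) + C.errorProb (fun _ => δ) d k *
          (Fs (d k) * Real.log (Fintype.card A) - Real.log t)) := by
    have : (Fintype.card (Library A Fs) : ℝ) * C.errorProb (fun _ => δ) d k =
        ∑ S : StateSeq K n, ∑ W : Library A Fs,
          if C.decoded d W S k ≠ W (d k) then stateProb (fun _ => δ) S else 0 := by
      unfold CachingScheme.errorProb
      rw [mul_div_cancel₀ _ hΩ, Finset.sum_comm]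
    rw [mul_add, ← mul_assoc, this]
    simp_rw [Finset.sum_add_distrib, mul_add, Finset.sum_add_distrib, ← Finset.sum_mul,
      sum_stateProb, Finset.mul_sum, Finset.sum_mul]
    congr 1
    · simp
    · refine Finset.sum_congr rfl fun S _ => Finset.sum_congr rfl fun W _ => ?_
      split_ifs <;> simp
  rw [herr] at hsum
  have e1 := sum_equivocation_sub_obsSetoid (δ := δ) C d U I
  have e2 := sum_equivocation_sub_obsSetoid (δ := δ) C d (U ⊓ Setoid.ker fun W => W (d k)) I
  have e3 : ∑ S : StateSeq K n, stateProb (fun _ => δ) S *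
      (equivocation U - equivocation (U ⊓ Setoid.ker fun W => W (d k))) =
      equivocation U - equivocation (U ⊓ Setoid.ker fun W => W (d k)) := by
    rw [← Finset.sum_mul, sum_stateProb, one_mul]
  rw [mul_sub (1 - δ ^ I.card), ← e1, ← e2, ← e3, ← Finset.sum_sub_distrib]
  refine le_trans (sub_le_sub_left hsum _) (le_of_eq ?_)
  rw [← Finset.sum_sub_distrib]
  refine Finset.sum_congr rfl fun S _ => ?_
  rw [inf_right_comm U (Setoid.ker fun W : Library A Fs => W (d k))]
  ring

/-! ### Outer bound on the number of slots -/

/-- Knowledge of the packets in `T`: two libraries are related if they agree on them. -/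
def agreeSetoid (A : Type*) {N : ℕ} {Fs : Fin N → ℕ} (T : Set ((i : Fin N) × Fin (Fs i))) :
    Setoid (Library A Fs) where
  r W W' := ∀ x ∈ T, W x.1 x.2 = W' x.1 x.2
  iseqv := ⟨fun _ _ _ => rfl, fun h x hx => (h x hx).symm,
    fun h h' x hx => (h x hx).trans (h' x hx)⟩

open Classical in
lemma equivocation_agreeSetoid (T : Set ((i : Fin N) × Fin (Fs i))) :
    equivocation (agreeSetoid A T) = Fintype.card (Library A Fs) *
      ((Finset.univ.filter fun x => x ∉ T).card * Real.log (Fintype.card A)) := by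
  have h : ∀ W : Library A Fs, cellCard (agreeSetoid A T) W =
      Fintype.card A ^ (Finset.univ.filter fun x => x ∉ T).card := by
    intro W
    have hc : cellCard (agreeSetoid A T) W = (Fintype.piFinset
        fun x : (i : Fin N) × Fin (Fs i) => if x ∈ T then {W x.1 x.2} else
          (Finset.univ : Finset A)).card := by
      refine Finset.card_equiv (Equiv.piCurry fun (i : Fin N) (_ : Fin (Fs i)) => A).symm
        fun W' => ?_
      rw [Finset.mem_filter, Fintype.mem_piFinset]
      simp only [Finset.mem_univ, true_and]
      refine forall_congr' fun x => ?_
      by_cases hx : x ∈ T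
      · simp only [hx, forall_true_left, if_true, Finset.mem_singleton]
        exact eq_comm
      · simp [hx]
    rw [hc, Fintype.card_piFinset, ← Finset.prod_const, Finset.prod_filter]
    refine Finset.prod_congr rfl fun x _ => ?_
    by_cases hx : x ∈ T <;> simp [hx]
  unfold equivocation
  simp_rw [h]
  simp [Real.log_pow]

open Classical in
/-- The packets of a file that are cached by nobody in `I`. -/
lemma card_filter_disjoint_place {b F : ℕ} (place : Fin F → Finset (Fin K))
    (hc : ∀ p, (place p).card = b)
    (hJ : ∀ J : Finset (Fin K), J.card = b →
      K.choose b * (Finset.univ.filter fun p => place p = J).card = F) (I : Finset (Fin K)) :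
    K.choose b * (Finset.univ.filter fun p => Disjoint (place p) I).card =
      (K - I.card).choose b * F := by
  have h : (Finset.univ.filter fun p => Disjoint (place p) I).card =
      ∑ J ∈ (Iᶜ).powersetCard b, (Finset.univ.filter fun p => place p = J).card := by
    rw [Finset.card_eq_sum_card_fiberwise (f := place) (t := (Iᶜ).powersetCard b)]
    · refine Finset.sum_congr rfl fun J hJ' => ?_
      congr 1
      ext p
      simp only [Finset.mem_filter, Finset.mem_univ, true_and, and_iff_right_iff_imp]
      rintro rfl
      rw [Finset.mem_powersetCard] at hJ'
      exact (Finset.subset_compl_iff_disjoint_right).1 hJ'.1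
    · intro p hp
      simp only [Finset.coe_filter, Finset.mem_univ, true_and, Set.mem_ofPred_eq] at hp
      exact Finset.mem_coe.2 (Finset.mem_powersetCard.2
        ⟨Finset.subset_compl_iff_disjoint_right.2 hp, hc p⟩)
  rw [h, Finset.mul_sum, Finset.sum_congr rfl fun J hJ' => hJ J (Finset.mem_powersetCard.1 hJ').2,
    Finset.sum_const, Finset.card_powersetCard, Finset.card_compl, Fintype.card_fin, smul_eq_mul]

open Classical in
/-- The first `j` users in the order `π`. -/
noncomputable def firstUsers (π : Equiv.Perm (Fin K)) (j : ℕ) : Finset (Fin K) :=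
  Finset.univ.filter fun k => (π.symm k).val < j

lemma card_firstUsers (π : Equiv.Perm (Fin K)) {j : ℕ} (hj : j ≤ K) :
    (firstUsers π j).card = j := by
  classical
  have : firstUsers π j = (Finset.univ.map (Fin.castLEEmb hj)).map π.toEmbedding := by
    ext k
    simp only [firstUsers, Finset.mem_filter, Finset.mem_univ, true_and, Finset.mem_map,
      Equiv.coe_toEmbedding, Fin.castLEEmb_apply]
    constructor
    · intro h
      exact ⟨π.symm k, ⟨⟨_, h⟩, rfl⟩, by simp⟩
    · rintro ⟨_, ⟨a, rfl⟩, rfl⟩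
      simp
  rw [this]
  simp

lemma firstUsers_mono (π : Equiv.Perm (Fin K)) {i j : ℕ} (h : i ≤ j) :
    firstUsers π i ⊆ firstUsers π j :=
  Finset.monotone_filter_right _ fun _ _ hk => lt_of_lt_of_le hk h

/-- The cut-set bound for the users in the order `π`: the `j`-th user is helped by all the channel
outputs and caches of its predecessors and by their files. -/
theorem slots_lower_bound [Nonempty A] (h0 : 0 ≤ δ) (h1 : δ < 1)
    (C : CachingScheme A K N M Fs n) {b : ℕ} (hbK : b ≤ K) (hC : C.IsCentralized b)
    (d : Fin K → Fin N)
    (hd : Function.Injective d) (π : Equiv.Perm (Fin K)) {ε t : ℝ} (t0 : 0 < t) (t1 : t < 1)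
    (hε : ∀ k, C.errorProb (fun _ => δ) d k ≤ ε) :
    ∑ j : Fin (K - b),
      (((K - (j.val + 1)).choose b : ℝ) / (K.choose b : ℝ) *
          Fs (d (π (Fin.castLE (Nat.sub_le K b) j))) * Real.log (Fintype.card A) -
        (-Real.log (1 - t) + ε * (Fs (d (π (Fin.castLE (Nat.sub_le K b) j))) *
          Real.log (Fintype.card A) - Real.log t))) / (1 - δ ^ (j.val + 1)) ≤
      n * Real.log (Fintype.card A) := by
  classical
  obtain ⟨place, hcard, hcount, hcache⟩ := hC
  set q := Real.log (Fintype.card A) with hq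
  have hq0 : 0 ≤ q := Real.log_natCast_nonneg _
  have hΩ : (0 : ℝ) < Fintype.card (Library A Fs) := by exact_mod_cast Fintype.card_pos
  obtain ⟨T, hTmem⟩ : ∃ T : ℕ → ℕ → Set ((i : Fin N) × Fin (Fs i)), ∀ a c x, x ∈ T a c ↔
      ¬ Disjoint (place x.1 x.2) (firstUsers π a) ∨ ∃ k ∈ firstUsers π c, x.1 = d k :=
    ⟨fun a c => {x | ¬ Disjoint (place x.1 x.2) (firstUsers π a) ∨
      ∃ k ∈ firstUsers π c, x.1 = d k}, fun _ _ _ => Iff.rfl⟩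
  let Φ : ℕ → ℕ → ℝ := fun a c => inputInfo C δ d (agreeSetoid A (T a c)) (firstUsers π a)
  have hstep : ∀ j : Fin (K - b),
      (((K - (j.val + 1)).choose b : ℝ) / (K.choose b : ℝ) *
          Fs (d (π (Fin.castLE (Nat.sub_le K b) j))) * q -
        (-Real.log (1 - t) + ε * (Fs (d (π (Fin.castLE (Nat.sub_le K b) j))) *
          q - Real.log t))) / (1 - δ ^ (j.val + 1)) ≤
      (Φ (j + 1) j - Φ (j + 1) (j + 1)) / Fintype.card (Library A Fs) := by
    intro j
    have hjK : j.val + 1 ≤ K := by omega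
    set k := π (Fin.castLE (Nat.sub_le K b) j) with hk
    have hkj : (π.symm k).val = j.val := by simp [hk]
    have hmem : k ∈ firstUsers π (j.val + 1) := by simp [firstUsers, hkj]
    have hδ : 0 < 1 - δ ^ (j.val + 1) := sub_pos.2 (pow_lt_one₀ h0 h1 (Nat.succ_ne_zero _))
    have hT : T (j + 1) (j + 1) = T (j + 1) j ∪ {x | x.1 = d k} := by
      ext x
      simp only [hTmem, Set.mem_union, or_assoc, Set.mem_ofPred_eq]
      refine or_congr_right ⟨?_, ?_⟩
      · rintro ⟨k', hk', hx⟩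
        simp only [firstUsers, Finset.mem_filter, Finset.mem_univ, true_and] at hk' ⊢
        rcases Nat.lt_succ_iff_lt_or_eq.1 hk' with h | h
        · exact Or.inl ⟨k', h, hx⟩
        · have : k' = k := π.symm.injective (Fin.ext (h.trans hkj.symm))
          exact Or.inr (this ▸ hx)
      · rintro (⟨k', hk', hx⟩ | hx)
        · exact ⟨k', firstUsers_mono π (Nat.le_succ _) hk', hx⟩
        · exact ⟨k, hmem, hx⟩
    have hinf : agreeSetoid A (T (j + 1) j) ⊓ Setoid.ker (fun W => W (d k)) =
        agreeSetoid A (T (j + 1) (j + 1)) := by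
      rw [hT]
      ext W W'
      constructor
      · rintro ⟨hW, hW'⟩ ⟨i, p⟩ (hx | hx)
        · exact hW _ hx
        · obtain rfl : i = d k := hx
          exact congrFun hW' p
      · exact fun hW => ⟨fun x hx => hW x (Or.inl hx), funext fun p => hW ⟨d k, p⟩ (Or.inr rfl)⟩
    have hdiff : equivocation (agreeSetoid A (T (j + 1) j)) -
        equivocation (agreeSetoid A (T (j + 1) (j + 1))) = Fintype.card (Library A Fs) *
          (((K - (j.val + 1)).choose b : ℝ) / (K.choose b : ℝ) * Fs (d k) * q) := by
      rw [equivocation_agreeSetoid, equivocation_agreeSetoid, ← mul_sub, ← sub_mul]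
      congr 2
      have hsplit : (Finset.univ.filter fun x => x ∉ T (j + 1) j).card =
          (Finset.univ.filter fun x => x ∉ T (j + 1) (j + 1)).card +
          (Finset.univ.filter fun p =>
            Disjoint (place (d k) p) (firstUsers π (j.val + 1))).card := by
        rw [← Finset.card_filter_add_card_filter_not (s := Finset.univ.filter
          fun x => x ∉ T (j + 1) j) (fun x => x.1 ≠ d k)]
        congr 1
        · congr 1
          ext x
          rw [hT]
          simp [not_or]
        · symm
          refine Finset.card_bij (fun p _ => ⟨d k, p⟩) (fun p hp => ?_) (fun p _ p' _ h => ?_)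
            fun x hx => ?_
          · simp only [Finset.mem_filter, Finset.mem_univ, true_and] at hp
            simp only [hTmem, Finset.mem_filter, Finset.mem_univ, true_and, not_or,
              not_not, not_exists, not_and, ne_eq, and_true]
            refine ⟨hp, fun k' hk' h => ?_⟩
            rw [← hd h] at hk'
            simp [firstUsers, hkj] at hk'
          · simpa using h
          · obtain ⟨i, p⟩ := x
            simp only [hTmem, Finset.mem_filter, Finset.mem_univ, true_and, not_or,
              not_not, ne_eq] at hx
            obtain ⟨⟨hx, -⟩, rfl⟩ := hx
            exact ⟨p, by simpa using hx, rfl⟩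
      have hcnt := card_filter_disjoint_place (place (d k)) (hcard _) (hcount _)
        (firstUsers π (j.val + 1))
      rw [card_firstUsers π hjK] at hcnt
      have hch : (K.choose b : ℝ) ≠ 0 := by exact_mod_cast (Nat.choose_pos hbK).ne'
      rw [hsplit, Nat.cast_add, add_sub_cancel_left, div_mul_eq_mul_div, eq_div_iff hch, mul_comm]
      exact_mod_cast hcnt
    have hmain := file_info_le_inputInfo h0 h1 C d k _ hmem (agreeSetoid A (T (j + 1) j))
      (fun W W' hW => ?_) t0 t1
    · rw [hinf, hdiff, card_firstUsers π hjK, ← mul_sub] at hmain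
      rw [div_le_div_iff₀ hδ hΩ]
      rw [mul_comm (_ - _) (1 - _), mul_comm _ (Fintype.card (Library A Fs) : ℝ)]
      refine le_trans (mul_le_mul_of_nonneg_left (sub_le_sub_left (add_le_add_right
        (mul_le_mul_of_nonneg_right (hε k) ?_) _) _) hΩ.le) hmain
      have : 0 ≤ Fs (d k) * q := by positivity
      have := Real.log_neg t0 t1
      linarith
    · obtain ⟨e, he⟩ := hcache k
      funext c
      rw [he, he]
      refine hW _ ((hTmem _ _ _).2 (Or.inl ?_))
      exact Finset.not_disjoint_iff.2 ⟨k, (e c).2, hmem⟩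
  have hanti : ∀ j, Φ (j + 1 + 1) (j + 1) ≤ Φ (j + 1) (j + 1) := by
    intro j
    refine inputInfo_mono h0 h1 C d (fun W W' hW x hx => hW x ?_) (firstUsers_mono π (Nat.le_succ _))
    rw [hTmem] at hx ⊢
    refine hx.imp_left fun h => ?_
    exact fun h' => h (h'.mono_right (firstUsers_mono π (Nat.le_succ _)))
  calc _ ≤ ∑ j : Fin (K - b), (Φ (j + 1) j - Φ (j + 1) (j + 1)) / Fintype.card (Library A Fs) :=
        Finset.sum_le_sum fun j _ => hstep j
    _ = (∑ j ∈ Finset.range (K - b), (Φ (j + 1) j - Φ (j + 1) (j + 1))) /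
          Fintype.card (Library A Fs) := by
        rw [← Finset.sum_div, ← Fin.sum_univ_eq_sum_range
          (fun j => Φ (j + 1) j - Φ (j + 1) (j + 1))]
    _ ≤ (∑ j ∈ Finset.range (K - b), (Φ (j + 1) j - Φ (j + 1 + 1) (j + 1))) /
          Fintype.card (Library A Fs) :=
        div_le_div_of_nonneg_right
          (Finset.sum_le_sum fun j _ => sub_le_sub_left (hanti j) _) hΩ.le
    _ ≤ Φ 1 0 / Fintype.card (Library A Fs) := by
        rw [Finset.sum_range_sub' (fun j => Φ (j + 1) j)]
        exact div_le_div_of_nonneg_right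
          (sub_le_self _ (inputInfo_nonneg h0 h1 C d _ _)) hΩ.le
    _ ≤ n * q := by
        rw [div_le_iff₀ hΩ]
        refine (inputInfo_le h0 h1 C d _ _).trans (le_of_eq ?_)
        ring

end Converse

/-! ### A queue-based linear code -/

section QueueCode

variable {A : Type*} {K n : ℕ} {P : Type*}

/-- The label `(U, I)` of the queue that a packet sent from the queue `x` joins if the users in
`s` receive it: within the group `U`, all receivers are added to `I`. -/
def joinLabel {K : ℕ} (x : Finset (Fin K) × Finset (Fin K)) (s : Finset (Fin K)) :
    Finset (Fin K) × Finset (Fin K) :=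
  (x.1, x.2 ∪ (s ∩ x.1))

/-- The queue labelled `u` consists of the source packets with that label and of the packets sent
earlier from other queues whose receivers moved them to `u`. -/
def InQueue (lab : P → Finset (Fin K) × Finset (Fin K))
    (σ : Fin n → Finset (Fin K) × Finset (Fin K)) (S : StateSeq K n)
    (u : Finset (Fin K) × Finset (Fin K)) : Fin n ⊕ P → Prop :=
  Sum.elim (fun j => σ j ≠ u ∧ joinLabel (σ j) (S j) = u) (fun p => lab p = u)

open Classical in
/-- The channel inputs of the code: in slot `l` the packets of the queue with label `σ l` are
combined with the coefficients `a l`. -/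
noncomputable def codeword [Field A] [Fintype P] (lab : P → Finset (Fin K) × Finset (Fin K))
    (σ : Fin n → Finset (Fin K) × Finset (Fin K)) (a : Fin n → Fin n ⊕ P → A)
    (W : P → A) (S : StateSeq K n) (l : Fin n) : A :=
  (∑ j : Fin n, if _h : j < l ∧ σ j ≠ σ l ∧ joinLabel (σ j) (S j) = σ l then
    a l (Sum.inl j) * codeword lab σ a W S j else 0) +
  ∑ p : P, if lab p = σ l then a l (Sum.inr p) * W p else 0
termination_by l.val
decreasing_by exact _h.1

open Classical in
/-- The slots that give user `k` an equation on the queue `u`: those in which it receives itself,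
and those whose packet moves to a larger queue, which `k` decodes separately. -/
noncomputable def equationSlots (σ : Fin n → Finset (Fin K) × Finset (Fin K)) (S : StateSeq K n)
    (k : Fin K) (u : Finset (Fin K) × Finset (Fin K)) : Finset (Fin n) :=
  Finset.univ.filter fun l => σ l = u ∧ (S l ∩ insert k (u.1 \ u.2)).Nonempty

open Classical in
/-- The packets of the queue `u` that user `k` neither received nor has cached. -/
noncomputable def unknownItems [Fintype P] (lab : P → Finset (Fin K) × Finset (Fin K))
    (known : Fin K → P → Prop) (σ : Fin n → Finset (Fin K) × Finset (Fin K)) (S : StateSeq K n)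
    (k : Fin K) (u : Finset (Fin K) × Finset (Fin K)) : Finset (Fin n ⊕ P) :=
  (Finset.univ.filter fun j =>
    σ j ≠ u ∧ joinLabel (σ j) (S j) = u ∧ k ∈ (σ j).2 ∧ k ∉ S j).disjSum
  (Finset.univ.filter fun p => lab p = u ∧ ¬ known k p)

/-- The rows in `T` of the matrix `a` have full column rank on the columns in `V`. -/
def FullColumnRankOn [Field A] {ι κ : Type*} [Fintype κ] (T : Finset ι) (V : Finset κ) (a : ι → κ → A) :
    Prop :=
  ∀ y : κ → A, (∀ x, x ∉ V → y x = 0) → (∀ l ∈ T, ∑ x, a l x * y x = 0) → y = 0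

variable [Field A] [Fintype P]

lemma codeword_congr (lab : P → Finset (Fin K) × Finset (Fin K))
    (σ : Fin n → Finset (Fin K) × Finset (Fin K)) (a : Fin n → Fin n ⊕ P → A)
    (W : P → A) (S S' : StateSeq K n) (l : Fin n) (h : ∀ j < l, S j = S' j) :
    codeword lab σ a W S l = codeword lab σ a W S' l := by
  induction l using WellFoundedLT.induction with
  | ind l ih =>
    rw [codeword, codeword]
    congr 1
    refine Finset.sum_congr rfl fun j _ => ?_
    by_cases hj : j < l
    · rw [h j hj, ih j hj fun i hi => h i (hi.trans hj)]
    · rw [dif_neg fun h' => hj h'.1, dif_neg fun h' => hj h'.1]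

open Classical in
lemma codeword_eq_sum (lab : P → Finset (Fin K) × Finset (Fin K))
    (σ : Fin n → Finset (Fin K) × Finset (Fin K)) (a : Fin n → Fin n ⊕ P → A)
    (hσ : ∀ j l, (σ j).1 = (σ l).1 → (σ j).2 ⊂ (σ l).2 → j < l)
    (W : P → A) (S : StateSeq K n) (l : Fin n) :
    codeword lab σ a W S l = ∑ x, if InQueue lab σ S (σ l) x then
      a l x * Sum.elim (codeword lab σ a W S) W x else 0 := by
  rw [Fintype.sum_sum_type, codeword]
  refine congrArg₂ (· + ·) (Finset.sum_congr rfl fun j _ => ?_)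
    (Finset.sum_congr rfl fun p _ => if_congr Iff.rfl rfl rfl)
  rw [dite_eq_ite]
  refine if_congr ⟨fun h => h.2, fun hj => ?_⟩ rfl rfl
  have hj : σ j ≠ σ l ∧ joinLabel (σ j) (S j) = σ l := hj
  have hfst : (σ j).1 = (σ l).1 := by
    rw [← hj.2]
    rfl
  have hsub : (σ j).2 ⊆ (σ l).2 := by
    rw [← hj.2]
    exact Finset.subset_union_left
  exact ⟨hσ j l hfst (hsub.ssubset_of_ne fun h => hj.1 (Prod.ext hfst h)), hj⟩

/-- Decoding by downward induction on `I`: if all linear systems of user `k` are solvable, then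
`k` learns all packets in the queues `(U, I)` with `k ∈ I`. -/
theorem eq_of_fullColumnRankOn {lab : P → Finset (Fin K) × Finset (Fin K)}
    {known : Fin K → P → Prop} {σ : Fin n → Finset (Fin K) × Finset (Fin K)}
    (hσ : ∀ j l, (σ j).1 = (σ l).1 → (σ j).2 ⊂ (σ l).2 → j < l)
    (hlab : ∀ p, (lab p).2 ⊆ (lab p).1)
    {a : Fin n → Fin n ⊕ P → A} {S : StateSeq K n} {k : Fin K}
    (ha : ∀ u : Finset (Fin K) × Finset (Fin K), k ∈ u.2 → u.2 ⊆ u.1 →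
      FullColumnRankOn (equationSlots σ S k u) (unknownItems lab known σ S k u) a)
    {W W' : P → A} (hknown : ∀ p, known k p → W p = W' p)
    (hrec : ∀ l, k ∈ S l → codeword lab σ a W S l = codeword lab σ a W' S l)
    (p : P) (hp : k ∈ (lab p).2) : W p = W' p := by
  classical
  suffices h : ∀ (m : ℕ) (u : Finset (Fin K) × Finset (Fin K)), K - u.2.card = m → k ∈ u.2 →
      u.2 ⊆ u.1 → ∀ x, InQueue lab σ S u x →
        Sum.elim (codeword lab σ a W S) W x = Sum.elim (codeword lab σ a W' S) W' x from
    h _ (lab p) rfl hp (hlab p) (Sum.inr p) rfl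
  intro m
  induction m using Nat.strong_induction_on with
  | _ m ih =>
    intro u hm hk hu x hx
    set v := Sum.elim (codeword lab σ a W S) W with hv
    set v' := Sum.elim (codeword lab σ a W' S) W' with hv'
    have hdiff : ∀ x, InQueue lab σ S u x → x ∉ unknownItems lab known σ S k u → v x = v' x := by
      rintro (j | p) hq hx
      · have hq' : σ j ≠ u ∧ joinLabel (σ j) (S j) = u := hq
        refine hrec j (by_contra fun hkS => hx ?_)
        simp only [unknownItems, Finset.inl_mem_disjSum, Finset.mem_filter, Finset.mem_univ,
          true_and]
        refine ⟨hq'.1, hq'.2, ?_, hkS⟩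
        rw [← hq'.2] at hk
        exact (Finset.mem_union.1 hk).resolve_right fun h => hkS (Finset.mem_inter.1 h).1
      · refine hknown p (by_contra fun hkn => hx ?_)
        simp only [unknownItems, Finset.inr_mem_disjSum, Finset.mem_filter, Finset.mem_univ,
          true_and]
        exact ⟨hq, hkn⟩
    have hunk : ∀ x, x ∈ unknownItems lab known σ S k u → InQueue lab σ S u x := by
      rintro (j | p) hx
      · simp only [unknownItems, Finset.inl_mem_disjSum, Finset.mem_filter, Finset.mem_univ,
          true_and] at hx
        exact ⟨hx.1, hx.2.1⟩
      · simp only [unknownItems, Finset.inr_mem_disjSum, Finset.mem_filter, Finset.mem_univ,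
          true_and] at hx
        exact hx.1
    have hcode : ∀ l ∈ equationSlots σ S k u,
        codeword lab σ a W S l = codeword lab σ a W' S l := by
      intro l hl
      obtain ⟨hl, i, hi⟩ := (Finset.mem_filter.1 hl).2
      rw [Finset.mem_inter, Finset.mem_insert, Finset.mem_sdiff] at hi
      rcases hi with ⟨hiS, rfl | ⟨hi1, hi2⟩⟩
      · exact hrec l hiS
      · have hss : u.2 ⊂ (joinLabel u (S l)).2 :=
          (Finset.ssubset_iff_of_subset Finset.subset_union_left).2
            ⟨i, Finset.mem_union_right _ (Finset.mem_inter.2 ⟨hiS, hi1⟩), hi2⟩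
        have hcard := Finset.card_lt_card hss
        have hle : (joinLabel u (S l)).2.card ≤ K := by
          simpa using Finset.card_le_univ (joinLabel u (S l)).2
        refine ih _ ?_ (joinLabel u (S l)) rfl (hss.1 hk)
          (Finset.union_subset hu Finset.inter_subset_right) (Sum.inl l) ⟨?_, by rw [hl]⟩
        · omega
        · rw [hl]
          exact fun h => hss.ne (congrArg Prod.snd h)
    have hy := ha u hk hu
      (fun x => if x ∈ unknownItems lab known σ S k u then v x - v' x else 0)
      (fun x hx => if_neg hx) fun l hl => by
        have hl' : σ l = u := (Finset.mem_filter.1 hl).2.1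
        have h := sub_eq_zero.2 (hcode l hl)
        rw [codeword_eq_sum lab σ a hσ, codeword_eq_sum lab σ a hσ, ← Finset.sum_sub_distrib,
          hl'] at h
        refine (Finset.sum_congr rfl fun x _ => ?_).trans h
        by_cases hx : x ∈ unknownItems lab known σ S k u
        · rw [if_pos hx, if_pos (hunk x hx), if_pos (hunk x hx), mul_sub]
        · by_cases hq : InQueue lab σ S u x
          · rw [if_neg hx, if_pos hq, if_pos hq, mul_zero, ← mul_sub, ← hv, ← hv', hdiff x hq hx,
              sub_self, mul_zero]
          · rw [if_neg hx, if_neg hq, if_neg hq, mul_zero, sub_self]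
    by_cases hxu : x ∈ unknownItems lab known σ S k u
    · have := congrFun hy x
      simp only [hxu, if_true, Pi.zero_apply] at this
      exact sub_eq_zero.1 this
    · exact hdiff x hx hxu

end QueueCode

/-! ### Random linear systems -/

section RandomMatrix

variable {A : Type*} [Field A] [Fintype A] {ι κ : Type*} [Fintype ι] [Fintype κ]
  [DecidableEq ι] [DecidableEq κ]

open Classical in
lemma card_orthogonal_mul (y : κ → A) (hy : y ≠ 0) :
    (Finset.univ.filter fun r : κ → A => ∑ x, r x * y x = 0).card * Fintype.card A ≤
      Fintype.card (κ → A) := by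
  obtain ⟨x₀, hx₀⟩ := Function.ne_iff.1 hy
  rw [← Finset.card_univ (α := A), ← Finset.card_product, ← Finset.card_univ (α := κ → A)]
  -- Moving an orthogonal vector along `x₀` realizes every value of the inner product once.
  have hval : ∀ (r : κ → A) (c : A), ∑ x, r x * y x = 0 →
      ∑ x, (r + Pi.single x₀ c : κ → A) x * y x = c * y x₀ := by
    intro r c hr
    simp only [Pi.add_apply, add_mul, Finset.sum_add_distrib, hr, zero_add]
    rw [Finset.sum_eq_single x₀ (fun x _ hx => by rw [Pi.single_eq_of_ne hx, zero_mul])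
      (fun h => absurd (Finset.mem_univ _) h), Pi.single_eq_same]
  refine Finset.card_le_card_of_injOn (fun z => z.1 + Pi.single x₀ z.2)
    (fun _ _ => Finset.mem_coe.2 (Finset.mem_univ _)) ?_
  rintro ⟨r, c⟩ hz ⟨r', c'⟩ hz' h
  simp only [Finset.coe_product, Set.mem_prod, Finset.mem_coe, Finset.mem_filter,
    Finset.mem_univ, true_and, and_true] at hz hz'
  simp only at h
  have h1 := hval r c hz
  rw [h, hval r' c' hz'] at h1
  obtain rfl := mul_right_cancel₀ hx₀ h1
  rw [add_left_inj] at h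
  rw [h]

open Classical in
/-- A uniformly random matrix fails to have full column rank with probability at most
`q ^ (|V| - |T|)`. -/
lemma card_not_fullColumnRankOn_mul_le (T : Finset ι) (V : Finset κ) :
    (Finset.univ.filter fun a : ι → κ → A => ¬ FullColumnRankOn T V a).card *
        Fintype.card A ^ T.card ≤
      Fintype.card A ^ V.card * Fintype.card (ι → κ → A) := by
  let Y : Finset (κ → A) := Fintype.piFinset fun x => if x ∈ V then Finset.univ else {0}
  have hY : Y.card = Fintype.card A ^ V.card := by
    have h : ∀ x, (if x ∈ V then Finset.univ else {0} : Finset A).card =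
        if x ∈ V then Fintype.card A else 1 := fun x => by by_cases hx : x ∈ V <;> simp [hx]
    rw [Fintype.card_piFinset, Finset.prod_congr rfl fun x _ => h x, Finset.prod_ite_mem]
    simp
  have hfix : ∀ y : κ → A, y ≠ 0 →
      (Finset.univ.filter fun a : ι → κ → A => ∀ l ∈ T, ∑ x, a l x * y x = 0).card *
        Fintype.card A ^ T.card ≤ Fintype.card (ι → κ → A) := by
    intro y hy
    have h : (Finset.univ.filter fun a : ι → κ → A => ∀ l ∈ T, ∑ x, a l x * y x = 0) =
        Fintype.piFinset fun l => if l ∈ T then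
          Finset.univ.filter (fun r : κ → A => ∑ x, r x * y x = 0) else Finset.univ := by
      ext a
      simp only [Finset.mem_filter, Finset.mem_univ, true_and, Fintype.mem_piFinset]
      refine forall_congr' fun l => ?_
      by_cases hl : l ∈ T <;> simp [hl]
    have h2 : Fintype.card A ^ T.card = ∏ l : ι, if l ∈ T then Fintype.card A else 1 := by
      rw [Finset.prod_ite_mem]
      simp
    rw [h, Fintype.card_piFinset, h2, ← Finset.prod_mul_distrib, Fintype.card_pi]
    refine Finset.prod_le_prod' fun l _ => ?_
    by_cases hl : l ∈ T
    · simp only [hl, if_true]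
      exact card_orthogonal_mul y hy
    · simp [hl]
  have hsub : (Finset.univ.filter fun a : ι → κ → A => ¬ FullColumnRankOn T V a) ⊆
      (Y.filter (· ≠ 0)).biUnion fun y =>
        Finset.univ.filter fun a : ι → κ → A => ∀ l ∈ T, ∑ x, a l x * y x = 0 := by
    intro a ha
    have ha' := (Finset.mem_filter.1 ha).2
    unfold FullColumnRankOn at ha'
    push Not at ha'
    obtain ⟨y, hyV, hyT, hy⟩ := ha'
    simp only [Finset.mem_biUnion, Finset.mem_filter, Finset.mem_univ, true_and]
    refine ⟨y, ⟨Fintype.mem_piFinset.2 fun x => ?_, hy⟩, hyT⟩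
    by_cases hx : x ∈ V
    · simp [hx]
    · simp [hx, hyV x hx]
  calc _ ≤ (∑ y ∈ Y.filter (· ≠ 0), (Finset.univ.filter fun a : ι → κ → A =>
          ∀ l ∈ T, ∑ x, a l x * y x = 0).card) * Fintype.card A ^ T.card :=
        Nat.mul_le_mul_right _ ((Finset.card_le_card hsub).trans Finset.card_biUnion_le)
    _ ≤ ∑ y ∈ Y.filter (· ≠ 0), Fintype.card (ι → κ → A) := by
        rw [Finset.sum_mul]
        exact Finset.sum_le_sum fun y hy => hfix y (Finset.mem_filter.1 hy).2
    _ ≤ _ := by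
        rw [Finset.sum_const, smul_eq_mul, ← hY]
        exact Nat.mul_le_mul_right _ (Finset.card_filter_le _ _)

open Classical in
/-- The exponential form of the failure probability: any rate `s ≤ log 2` is allowed, whatever the
field. -/
lemma card_not_fullColumnRankOn_le_exp (T : Finset ι) (V : Finset κ) {s : ℝ} (s0 : 0 ≤ s)
    (s2 : s ≤ Real.log 2) :
    ((Finset.univ.filter fun a : ι → κ → A => ¬ FullColumnRankOn T V a).card : ℝ) ≤
      Real.exp (-s * ((T.card : ℝ) - V.card)) * Fintype.card (ι → κ → A) := by
  rcases le_total T.card V.card with h | h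
  · have h' : (T.card : ℝ) ≤ V.card := by exact_mod_cast h
    have h1 : (1 : ℝ) ≤ Real.exp (-s * ((T.card : ℝ) - V.card)) := by
      rw [Real.one_le_exp_iff]
      nlinarith
    have h2 : ((Finset.univ.filter fun a : ι → κ → A => ¬ FullColumnRankOn T V a).card : ℝ) ≤
        Fintype.card (ι → κ → A) := by exact_mod_cast Finset.card_le_univ _
    exact h2.trans (le_mul_of_one_le_left (by positivity) h1)
  · have h' : (V.card : ℝ) ≤ T.card := by exact_mod_cast h
    have hq : (2 : ℝ) ≤ Fintype.card A := by exact_mod_cast Fintype.one_lt_card (α := A)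
    have hq0 : (0 : ℝ) < Fintype.card A := by linarith
    have hs : s ≤ Real.log (Fintype.card A) := s2.trans (Real.log_le_log two_pos hq)
    have h1 := card_not_fullColumnRankOn_mul_le (A := A) T V
    have h2 : ((Finset.univ.filter fun a : ι → κ → A => ¬ FullColumnRankOn T V a).card : ℝ) *
        (Fintype.card A : ℝ) ^ T.card ≤
        (Fintype.card A : ℝ) ^ V.card * Fintype.card (ι → κ → A) := by exact_mod_cast h1
    rw [← le_div_iff₀ (by positivity)] at h2
    refine h2.trans ?_
    rw [mul_div_right_comm]
    refine mul_le_mul_of_nonneg_right ?_ (by positivity)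
    rw [← Real.exp_log (show 0 < (Fintype.card A : ℝ) ^ V.card / (Fintype.card A : ℝ) ^ T.card by
      positivity), Real.log_div (by positivity) (by positivity), Real.log_pow, Real.log_pow]
    apply Real.exp_le_exp.2
    nlinarith

end RandomMatrix

/-! ### Failure probability of the queue-based code -/

section Failure

open Classical

variable {A : Type*} {K n : ℕ} {P : Type*} {δ : ℝ}

/-- Contribution of slot `l` with state `s` to the number of equations minus the number of unknowns
of user `k` in the queue `u`. -/
noncomputable def slotBalance (σ : Fin n → Finset (Fin K) × Finset (Fin K)) (k : Fin K)
    (u : Finset (Fin K) × Finset (Fin K)) (l : Fin n) (s : Finset (Fin K)) : ℝ :=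
  (if σ l = u ∧ (s ∩ insert k (u.1 \ u.2)).Nonempty then 1 else 0) -
    if σ l ≠ u ∧ joinLabel (σ l) s = u ∧ k ∈ (σ l).2 ∧ k ∉ s then 1 else 0

lemma abs_slotBalance_le (σ : Fin n → Finset (Fin K) × Finset (Fin K)) (k : Fin K)
    (u : Finset (Fin K) × Finset (Fin K)) (l : Fin n) (s : Finset (Fin K)) :
    |slotBalance σ k u l s| ≤ 1 := by
  unfold slotBalance
  split_ifs <;> norm_num

lemma card_equationSlots_sub [Fintype P] (lab : P → Finset (Fin K) × Finset (Fin K))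
    (known : Fin K → P → Prop) (σ : Fin n → Finset (Fin K) × Finset (Fin K)) (S : StateSeq K n)
    (k : Fin K) (u : Finset (Fin K) × Finset (Fin K)) :
    ((equationSlots σ S k u).card : ℝ) - (unknownItems lab known σ S k u).card =
      ∑ l, slotBalance σ k u l (S l) -
        (Finset.univ.filter fun p => lab p = u ∧ ¬ known k p).card := by
  unfold equationSlots unknownItems slotBalance
  rw [Finset.card_disjSum, Finset.sum_sub_distrib, Finset.sum_boole, Finset.sum_boole]
  push_cast
  ring

/-- The expected balance of a slot. -/
lemma sum_slotProb_mul_slotBalance (σ : Fin n → Finset (Fin K) × Finset (Fin K)) (k : Fin K)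
    (u : Finset (Fin K) × Finset (Fin K)) (hk : k ∈ u.2) (hu : u.2 ⊆ u.1) (l : Fin n) :
    ∑ s, slotProb δ s * slotBalance σ k u l s =
      (if σ l = u then 1 - δ ^ ((u.1 \ u.2).card + 1) else 0) -
        if (σ l).1 = u.1 ∧ k ∈ (σ l).2 ∧ (σ l).2 ⊂ u.2 then
          (1 - δ) ^ (u.2 \ (σ l).2).card * δ ^ ((u.1 \ u.2).card + 1) else 0 := by
  have hcard : (insert k (u.1 \ u.2)).card = (u.1 \ u.2).card + 1 :=
    Finset.card_insert_of_notMem fun h => (Finset.mem_sdiff.1 h).2 hk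
  unfold slotBalance
  simp_rw [mul_sub, Finset.sum_sub_distrib]
  congr 1
  · by_cases hl : σ l = u
    · simp only [hl, true_and, if_true]
      rw [← hcard, ← sum_slotProb_nonempty]
    · simp [hl]
  · by_cases hl : (σ l).1 = u.1 ∧ k ∈ (σ l).2 ∧ (σ l).2 ⊂ u.2
    · obtain ⟨h1, h2, h3⟩ := hl
      rw [if_pos ⟨h1, h2, h3⟩, ← hcard, ← sum_slotProb_indicator]
      · refine Finset.sum_congr rfl fun s _ => ?_
        congr 1
        refine if_congr ?_ rfl rfl
        rw [Finset.disjoint_insert_right]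
        constructor
        · rintro ⟨-, hj, -, hks⟩
          have hj2 : (σ l).2 ∪ (s ∩ u.1) = u.2 := by
            rw [← h1]
            exact congrArg Prod.snd hj
          refine ⟨fun i hi => ?_, hks, Finset.disjoint_left.2 fun i his hi => ?_⟩
          · rw [Finset.mem_sdiff, ← hj2, Finset.mem_union] at hi
            exact (Finset.mem_inter.1 (hi.1.resolve_left hi.2)).1
          · rw [Finset.mem_sdiff, ← hj2] at hi
            exact hi.2 (Finset.mem_union_right _ (Finset.mem_inter.2 ⟨his, hi.1⟩))
        · rintro ⟨hs, hks, hd⟩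
          refine ⟨fun h => h3.ne (congrArg Prod.snd h), Prod.ext h1 ?_, h2, hks⟩
          change (σ l).2 ∪ (s ∩ (σ l).1) = u.2
          rw [h1]
          refine Finset.Subset.antisymm (Finset.union_subset h3.1 fun i hi => ?_) fun i hi => ?_
          · rw [Finset.mem_inter] at hi
            by_contra hi2
            exact Finset.disjoint_left.1 hd hi.1 (Finset.mem_sdiff.2 ⟨hi.2, hi2⟩)
          · by_cases hi2 : i ∈ (σ l).2
            · exact Finset.mem_union_left _ hi2
            · exact Finset.mem_union_right _ (Finset.mem_inter.2
                ⟨hs (Finset.mem_sdiff.2 ⟨hi, hi2⟩), hu hi⟩)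
      · rw [Finset.disjoint_insert_right]
        refine ⟨fun h => (Finset.mem_sdiff.1 h).2 h2, Finset.disjoint_left.2 fun i hi hi' => ?_⟩
        exact (Finset.mem_sdiff.1 hi').2 (Finset.mem_sdiff.1 hi).1
    · rw [if_neg hl]
      refine Finset.sum_eq_zero fun s _ => ?_
      rw [if_neg, mul_zero]
      rintro ⟨h1, h2, h3, -⟩
      have hfst : (σ l).1 = u.1 := by
        rw [← h2]
        rfl
      have hsub : (σ l).2 ⊆ u.2 := by
        rw [← h2]
        exact Finset.subset_union_left
      exact hl ⟨hfst, h3, hsub.ssubset_of_ne fun h => h1 (Prod.ext hfst h)⟩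

/-- Chernoff's bound for sums of independent variables bounded by `1`. -/
lemma sum_stateProb_mul_exp_le (h0 : 0 ≤ δ) (h1 : δ < 1) (ψ : Fin n → Finset (Fin K) → ℝ)
    (hψ : ∀ l s, |ψ l s| ≤ 1) {s : ℝ} (s0 : 0 ≤ s) (s1 : s ≤ 1) :
    ∑ S : StateSeq K n, stateProb (fun _ => δ) S * Real.exp (-s * ∑ l, ψ l (S l)) ≤
      Real.exp (-s * ∑ l, ∑ x, slotProb δ x * ψ l x + n * s ^ 2) := by
  have hexp : ∀ S : StateSeq K n, Real.exp (-s * ∑ l, ψ l (S l)) =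
      ∏ l, Real.exp (-s * ψ l (S l)) := fun S => by rw [Finset.mul_sum, Real.exp_sum]
  simp_rw [hexp]
  rw [sum_stateProb_mul_prod fun l x => Real.exp (-s * ψ l x)]
  have hslot : ∀ l, ∑ x, slotProb δ x * Real.exp (-s * ψ l x) ≤
      Real.exp (-s * ∑ x, slotProb δ x * ψ l x + s ^ 2) := by
    intro l
    calc ∑ x, slotProb δ x * Real.exp (-s * ψ l x)
        ≤ ∑ x, slotProb δ x * (1 + -s * ψ l x + s ^ 2) := by
          refine Finset.sum_le_sum fun x _ =>
            mul_le_mul_of_nonneg_left ?_ (slotProb_nonneg h0 h1 x)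
          have ha : |-s * ψ l x| ≤ s := by
            rw [abs_mul, abs_neg, abs_of_nonneg s0]
            exact mul_le_of_le_one_right s0 (hψ l x)
          have hb := (abs_le.1 (Real.abs_exp_sub_one_sub_id_le (ha.trans s1))).2
          have hc : (-s * ψ l x) ^ 2 ≤ s ^ 2 := sq_le_sq' (by linarith [neg_abs_le (-s * ψ l x)])
            ((le_abs_self _).trans ha)
          linarith
      _ = -s * ∑ x, slotProb δ x * ψ l x + s ^ 2 + 1 := by
          simp_rw [mul_add, Finset.sum_add_distrib, mul_one, sum_slotProb, ← Finset.sum_mul,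
            sum_slotProb, Finset.mul_sum]
          have : ∀ x, slotProb δ x * (-s * ψ l x) = -s * (slotProb δ x * ψ l x) :=
            fun x => by ring
          simp_rw [this]
          ring
      _ ≤ _ := Real.add_one_le_exp _
  calc _ ≤ ∏ l : Fin n, Real.exp (-s * ∑ x, slotProb δ x * ψ l x + s ^ 2) :=
        Finset.prod_le_prod (fun l _ => Finset.sum_nonneg fun x _ =>
          mul_nonneg (slotProb_nonneg h0 h1 x) (Real.exp_nonneg _)) fun l _ => hslot l
    _ = _ := by
        rw [← Real.exp_sum, Finset.sum_add_distrib, ← Finset.mul_sum]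
        simp

/-- If every queue has on average `D` more equations than unknowns, for every user, then some
choice of the coefficients makes all linear systems solvable with high probability. -/
theorem exists_coefficients [Field A] [Fintype A] [Fintype P] (h0 : 0 ≤ δ) (h1 : δ < 1)
    (lab : P → Finset (Fin K) × Finset (Fin K)) (known : Fin K → P → Prop)
    (σ : Fin n → Finset (Fin K) × Finset (Fin K)) {s D : ℝ} (s0 : 0 ≤ s) (s2 : s ≤ Real.log 2)
    (hD : ∀ (k : Fin K) (u : Finset (Fin K) × Finset (Fin K)), k ∈ u.2 → u.2 ⊆ u.1 →
      ((Finset.univ.filter fun p => lab p = u ∧ ¬ known k p).card : ℝ) + D ≤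
        ∑ l, ∑ x, slotProb δ x * slotBalance σ k u l x) :
    ∃ a : Fin n → Fin n ⊕ P → A, ∀ k, ∑ S : StateSeq K n,
      (if ∃ u : Finset (Fin K) × Finset (Fin K), k ∈ u.2 ∧ u.2 ⊆ u.1 ∧
        ¬ FullColumnRankOn (equationSlots σ S k u) (unknownItems lab known σ S k u) a then
        stateProb (fun _ => δ) S else 0) ≤
      Fintype.card (Fin K × Finset (Fin K) × Finset (Fin K)) *
        Real.exp (-s * D + n * s ^ 2) := by
  set B := Real.exp (-s * D + n * s ^ 2) with hB
  obtain ⟨bad, hbad⟩ : ∃ bad : (Fin n → Fin n ⊕ P → A) →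
      Fin K × Finset (Fin K) × Finset (Fin K) → StateSeq K n → Prop,
      ∀ a x S, bad a x S ↔ x.1 ∈ x.2.2 ∧ x.2.2 ⊆ x.2.1 ∧ ¬ FullColumnRankOn
        (equationSlots σ S x.1 x.2) (unknownItems lab known σ S x.1 x.2) a :=
    ⟨_, fun _ _ _ => Iff.rfl⟩
  have hP := fun S : StateSeq K n => stateProb_nonneg (δ := δ) h0 h1 S
  have hcount : ∀ x S, ((Finset.univ.filter fun a => bad a x S).card : ℝ) ≤
      Real.exp (-s * (∑ l, slotBalance σ x.1 x.2 l (S l))) *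
        (Real.exp (s * (Finset.univ.filter fun p => lab p = x.2 ∧ ¬ known x.1 p).card) *
          Fintype.card (Fin n → Fin n ⊕ P → A)) := by
    intro x S
    have hsub : (Finset.univ.filter fun a => bad a x S) ⊆ Finset.univ.filter fun a =>
        ¬ FullColumnRankOn (equationSlots σ S x.1 x.2) (unknownItems lab known σ S x.1 x.2) a :=
      Finset.monotone_filter_right _ fun a _ ha => ((hbad _ _ _).1 ha).2.2
    have hle := card_not_fullColumnRankOn_le_exp (A := A) (equationSlots σ S x.1 x.2)
      (unknownItems lab known σ S x.1 x.2) s0 s2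
    rw [card_equationSlots_sub, mul_sub, sub_eq_add_neg, Real.exp_add, mul_assoc] at hle
    rw [neg_mul s (Finset.card _ : ℝ), neg_neg] at hle
    exact le_trans (Nat.cast_le.2 (Finset.card_le_card hsub)) hle
  have hone : ∀ x, ∑ a, ∑ S, (if bad a x S then stateProb (fun _ => δ) S else 0) ≤
      Fintype.card (Fin n → Fin n ⊕ P → A) * B := by
    intro x
    by_cases hx : x.1 ∈ x.2.2 ∧ x.2.2 ⊆ x.2.1
    swap
    · have : ∀ a S, ¬ bad a x S := fun a S h =>
        hx ⟨((hbad _ _ _).1 h).1, ((hbad _ _ _).1 h).2.1⟩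
      simp only [this, if_false, Finset.sum_const_zero]
      positivity
    rw [Finset.sum_comm]
    calc ∑ S, ∑ a, (if bad a x S then stateProb (fun _ => δ) S else 0)
        ≤ ∑ S : StateSeq K n, stateProb (fun _ => δ) S *
            (Real.exp (-s * (∑ l, slotBalance σ x.1 x.2 l (S l))) *
              (Real.exp (s * (Finset.univ.filter fun p => lab p = x.2 ∧ ¬ known x.1 p).card) *
                Fintype.card (Fin n → Fin n ⊕ P → A))) := by
          refine Finset.sum_le_sum fun S _ => ?_
          rw [← Finset.sum_filter, Finset.sum_const, nsmul_eq_mul, mul_comm]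
          exact mul_le_mul_of_nonneg_left (hcount x S) (hP S)
      _ = (∑ S : StateSeq K n, stateProb (fun _ => δ) S *
            Real.exp (-s * (∑ l, slotBalance σ x.1 x.2 l (S l)))) *
              (Real.exp (s * (Finset.univ.filter fun p => lab p = x.2 ∧ ¬ known x.1 p).card) *
                Fintype.card (Fin n → Fin n ⊕ P → A)) := by
          rw [Finset.sum_mul]
          exact Finset.sum_congr rfl fun S _ => by ring
      _ ≤ Real.exp (-s * (∑ l, ∑ y, slotProb δ y * slotBalance σ x.1 x.2 l y) + n * s ^ 2) *
              (Real.exp (s * (Finset.univ.filter fun p => lab p = x.2 ∧ ¬ known x.1 p).card) *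
                Fintype.card (Fin n → Fin n ⊕ P → A)) :=
          mul_le_mul_of_nonneg_right (sum_stateProb_mul_exp_le h0 h1 _
            (abs_slotBalance_le σ x.1 x.2) s0 (s2.trans (by linarith [Real.log_two_lt_d9])))
            (by positivity)
      _ ≤ Fintype.card (Fin n → Fin n ⊕ P → A) * B := by
          rw [← mul_assoc, ← Real.exp_add, mul_comm]
          refine mul_le_mul_of_nonneg_left (Real.exp_le_exp.2 ?_) (by positivity)
          have := mul_le_mul_of_nonneg_left (hD x.1 x.2 hx.1 hx.2) s0
          linarith
  obtain ⟨a, -, ha⟩ : ∃ a ∈ (Finset.univ : Finset (Fin n → Fin n ⊕ P → A)),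
      ∑ x, ∑ S, (if bad a x S then stateProb (fun _ => δ) S else 0) ≤
        Fintype.card (Fin K × Finset (Fin K) × Finset (Fin K)) * B := by
    refine Finset.exists_le_of_sum_le Finset.univ_nonempty ?_
    rw [Finset.sum_comm]
    refine (Finset.sum_le_sum fun x _ => hone x).trans (le_of_eq ?_)
    simp only [Finset.sum_const, Finset.card_univ, nsmul_eq_mul]
    ring
  refine ⟨a, fun k => le_trans ?_ ha⟩
  rw [Finset.sum_comm]
  refine Finset.sum_le_sum fun S _ => ?_
  have hnn : ∀ x ∈ (Finset.univ : Finset (Fin K × Finset (Fin K) × Finset (Fin K))),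
      0 ≤ if bad a x S then stateProb (fun _ => δ) S else 0 := fun x _ => by
    split_ifs
    exacts [hP S, le_rfl]
  by_cases h : ∃ u : Finset (Fin K) × Finset (Fin K), k ∈ u.2 ∧ u.2 ⊆ u.1 ∧
        ¬ FullColumnRankOn (equationSlots σ S k u) (unknownItems lab known σ S k u) a
  · rw [if_pos h]
    obtain ⟨u, hu⟩ := h
    refine le_trans ?_ (Finset.single_le_sum hnn (Finset.mem_univ (k, u)))
    rw [if_pos ((hbad _ _ _).2 hu)]
  · rw [if_neg h]
    exact Finset.sum_nonneg hnn

end Failure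

/-! ### Schemes with centralized placement -/

section Scheme

open Classical

variable {A : Type*} {K N n b : ℕ} {Fs : Fin N → ℕ} {δ : ℝ}

/-- Under a centralized placement a user caches the fraction `b / K` of the library. -/
lemma card_cached (hK : 0 < K) (hbK : b ≤ K)
    (place : (i : Fin N) → Fin (Fs i) → Finset (Fin K)) (hcard : ∀ i p, (place i p).card = b)
    (hcount : ∀ (i : Fin N) (J : Finset (Fin K)), J.card = b →
      K.choose b * (Finset.univ.filter fun p => place i p = J).card = Fs i) (k : Fin K) :
    (Fintype.card {x : (i : Fin N) × Fin (Fs i) // k ∈ place x.1 x.2} : ℝ) =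
      b / K * ∑ i, (Fs i : ℝ) := by
  have hch : (K.choose b : ℝ) ≠ 0 := by exact_mod_cast (Nat.choose_pos hbK).ne'
  have hK' : (K : ℝ) ≠ 0 := by exact_mod_cast hK.ne'
  have hone : ∀ i, ((Finset.univ.filter fun p => k ∈ place i p).card : ℝ) = b / K * Fs i := by
    intro i
    have h1 := card_filter_disjoint_place (place i) (hcard i) (hcount i) {k}
    have h2 := Finset.card_filter_add_card_filter_not (s := (Finset.univ : Finset (Fin (Fs i))))
      (fun p => k ∈ place i p)
    simp only [Finset.disjoint_singleton_right, Finset.card_singleton] at h1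
    rw [Finset.card_univ, Fintype.card_fin] at h2
    have h3 : (K - 1).choose b * K = K.choose b * (K - b) := by
      obtain ⟨K', rfl⟩ : ∃ K', K = K' + 1 := ⟨K - 1, by omega⟩
      exact Nat.choose_mul_succ_eq K' b
    have h1' : (K.choose b : ℝ) * (Finset.univ.filter fun p => k ∉ place i p).card =
        (K - 1).choose b * Fs i := by exact_mod_cast h1
    have h2' : ((Finset.univ.filter fun p => k ∈ place i p).card : ℝ) +
        (Finset.univ.filter fun p => k ∉ place i p).card = Fs i := by exact_mod_cast h2
    have h3' : ((K - 1).choose b : ℝ) * K = K.choose b * (K - b) := by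
      rw [← Nat.cast_sub hbK]
      exact_mod_cast h3
    rw [div_mul_eq_mul_div, eq_div_iff hK']
    apply mul_left_cancel₀ hch
    linear_combination (K.choose b : ℝ) * K * h2' - K * h1' - Fs i * h3'
  have hsig : Fintype.card {x : (i : Fin N) × Fin (Fs i) // k ∈ place x.1 x.2} =
      ∑ i, (Finset.univ.filter fun p => k ∈ place i p).card := by
    rw [Fintype.card_subtype, ← Finset.card_sigma]
    congr 1
    ext x
    simp
  rw [hsig, Nat.cast_sum, Finset.sum_congr rfl fun i _ => hone i, ← Finset.mul_sum]

/-- A placement and encoders give a scheme in which every user decodes by looking for a library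
that is consistent with its cache and its channel outputs. User `k` errs only in the states of
`bad d k` if in all others its observation determines its file. -/
theorem exists_scheme [Fintype A] [Nonempty A] (h0 : 0 ≤ δ) (h1 : δ < 1) {M : ℝ} (hK : 0 < K)
    (hbK : b ≤ K) (hb : (b : ℝ) = M * K / N)
    (place : (i : Fin N) → Fin (Fs i) → Finset (Fin K)) (hcard : ∀ i p, (place i p).card = b)
    (hcount : ∀ (i : Fin N) (J : Finset (Fin K)), J.card = b →
      K.choose b * (Finset.univ.filter fun p => place i p = J).card = Fs i)
    (enc : (d : Fin K → Fin N) → (l : Fin n) →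
      ((k : Fin K) → Fin (Fs (d k)) → A) → StateSeq K l.val → A)
    (bad : (Fin K → Fin N) → Fin K → StateSeq K n → Prop)
    (hdec : ∀ d k S, ¬ bad d k S → ∀ W W' : Library A Fs,
      (∀ i p, k ∈ place i p → W i p = W' i p) →
      (∀ l, k ∈ S l → enc d l (fun k => W (d k)) (pastStates S l) =
        enc d l (fun k => W' (d k)) (pastStates S l)) → W (d k) = W' (d k)) :
    ∃ C : CachingScheme A K N (fun _ => M) Fs n, C.IsCentralized b ∧ ∀ d k,
      C.errorProb (fun _ => δ) d k ≤
        ∑ S : StateSeq K n, if bad d k S then stateProb (fun _ => δ) S else 0 := by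
  obtain ⟨w₀⟩ := ‹Nonempty A›
  let e := fun k : Fin K =>
    (Fintype.equivFin {x : (i : Fin N) × Fin (Fs i) // k ∈ place x.1 x.2}).symm
  let cache := fun (k : Fin K) (W : Library A Fs)
    (c : Fin (Fintype.card {x : (i : Fin N) × Fin (Fs i) // k ∈ place x.1 x.2})) =>
      W (e k c).1.1 (e k c).1.2
  let output := fun (d : Fin K → Fin N) (W : Library A Fs) (S : StateSeq K n) (k : Fin K)
    (l : Fin n) => if k ∈ S l then some (enc d l (fun k => W (d k)) (pastStates S l)) else none
  let C : CachingScheme A K N (fun _ => M) Fs n :=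
    { cacheSize := fun k =>
        Fintype.card {x : (i : Fin N) × Fin (Fs i) // k ∈ place x.1 x.2}
      memory := fun k => by
        rw [card_cached hK hbK place hcard hcount k, hb]
        have hK' : (K : ℝ) ≠ 0 := by exact_mod_cast hK.ne'
        apply le_of_eq
        field_simp
      cache := cache
      enc := enc
      dec := fun d k y z S =>
        if h : ∃ W : Library A Fs, cache k W = z ∧ output d W S k = y then h.choose (d k)
        else fun _ => w₀ }
  refine ⟨C, ⟨place, hcard, hcount, fun k => ⟨e k, fun _ _ => rfl⟩⟩, fun d k => ?_⟩
  have hgood : ∀ S, ¬ bad d k S → ∀ W, C.decoded d W S k = W (d k) := by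
    intro S hS W
    have hex : ∃ W' : Library A Fs, cache k W' = cache k W ∧ output d W' S k = output d W S k :=
      ⟨W, rfl, rfl⟩
    have hdecoded : C.decoded d W S k = hex.choose (d k) := dif_pos hex
    rw [hdecoded]
    obtain ⟨hc, ho⟩ := hex.choose_spec
    refine hdec d k S hS _ _ (fun i p hp => ?_) fun l hl => ?_
    · have := congrFun hc ((e k).symm ⟨⟨i, p⟩, hp⟩)
      simp only [cache] at this
      rwa [Equiv.apply_symm_apply] at this
    · have := congrFun ho l
      simpa [output, hl] using this
  have hΩ : (0 : ℝ) < Fintype.card (Library A Fs) := by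
    have : Nonempty (Library A Fs) := ⟨fun _ _ => w₀⟩
    exact_mod_cast Fintype.card_pos
  unfold CachingScheme.errorProb
  rw [div_le_iff₀ hΩ]
  calc _ ≤ ∑ W : Library A Fs, ∑ S : StateSeq K n,
        (if bad d k S then stateProb (fun _ => δ) S else 0) := by
        refine Finset.sum_le_sum fun W _ => Finset.sum_le_sum fun S _ => ?_
        by_cases hS : bad d k S
        · rw [if_pos hS]
          split_ifs
          exacts [le_rfl, stateProb_nonneg h0 h1 S]
        · rw [if_neg hS, if_neg (not_not.2 (hgood S hS W))]
    _ = _ := by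
        rw [Finset.sum_const, Finset.card_univ, nsmul_eq_mul, mul_comm]

/-- Files of `K.choose b * h i` packets can be split into sub-files, with the packets of each
sub-file numbered by `idx`. -/
lemma exists_placement (b : ℕ) (h : Fin N → ℕ) :
    ∃ (place : (i : Fin N) → Fin (K.choose b * h i) → Finset (Fin K))
      (idx : (i : Fin N) → Fin (K.choose b * h i) → ℕ),
      (∀ i p, (place i p).card = b) ∧ (∀ i p, idx i p < h i) ∧
      (∀ (i : Fin N) (J : Finset (Fin K)), J.card = b →
        K.choose b * (Finset.univ.filter fun p => place i p = J).card = K.choose b * h i) ∧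
      ∀ i p p', place i p = place i p' → idx i p = idx i p' → p = p' := by
  have hc : Fintype.card ((Finset.univ : Finset (Fin K)).powersetCard b) = K.choose b := by
    simp
  let e₀ := Fintype.equivFinOfCardEq hc
  let e : (i : Fin N) → Fin (K.choose b * h i) ≃
      (Finset.univ : Finset (Fin K)).powersetCard b × Fin (h i) :=
    fun i => finProdFinEquiv.symm.trans (e₀.symm.prodCongr (Equiv.refl _))
  refine ⟨fun i p => (e i p).1.1, fun i p => (e i p).2.val,
    fun i p => (Finset.mem_powersetCard.1 (e i p).1.2).2, fun i p => (e i p).2.isLt,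
    fun i J hJ => ?_, fun i p p' h1 h2 =>
      (e i).injective (Prod.ext (Subtype.ext h1) (Fin.ext h2))⟩
  congr 1
  have hJ' : J ∈ (Finset.univ : Finset (Fin K)).powersetCard b :=
    Finset.mem_powersetCard.2 ⟨Finset.subset_univ _, hJ⟩
  have hinj : Function.Injective fun c : Fin (h i) => (e i).symm (⟨J, hJ'⟩, c) :=
    fun c c' hcc => by simpa using hcc
  refine Eq.trans ?_ ((Finset.card_image_of_injective Finset.univ hinj).trans (by simp))
  congr 1
  ext p
  simp only [Finset.mem_filter, Finset.mem_univ, true_and, Finset.mem_image]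
  constructor
  · rintro rfl
    exact ⟨(e i p).2, by simp⟩
  · rintro ⟨c, rfl⟩
    simp

/-- The number of sets of `b` users that meet a group of `m` users in a given set of `i` of its
members. -/
def outsideChoose (K b m i : ℕ) : ℕ := if i ≤ b then (K - m).choose (b - i) else 0

/-- The group of a packet with number `x` in its sub-file: the users whose sub-files have more than
`x` packets. -/
def packetGroup (g : Fin K → ℕ) (x : ℕ) : Finset (Fin K) := Finset.univ.filter fun k => x < g k

/-- The number of packet numbers whose group is `U`. -/
def groupSize (g : Fin K → ℕ) (U : Finset (Fin K)) : ℕ :=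
  ((Finset.range (Finset.univ.sup g)).filter fun x => packetGroup g x = U).card

lemma card_place_inter_le {U I : Finset (Fin K)} {k : Fin K} (hkI : k ∈ I) (hIU : I ⊆ U) :
    (((Finset.univ : Finset (Fin K)).powersetCard b).filter
      fun J => k ∉ J ∧ insert k (J ∩ U) = I).card ≤ outsideChoose K b U.card (I.card - 1) := by
  have hinter : ∀ J : Finset (Fin K), k ∉ J → insert k (J ∩ U) = I → J ∩ U = I.erase k := by
    rintro J hk rfl
    rw [Finset.erase_insert fun h => hk (Finset.mem_inter.1 h).1]
  have hcardJ : ∀ J ∈ ((Finset.univ : Finset (Fin K)).powersetCard b).filter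
      (fun J => k ∉ J ∧ insert k (J ∩ U) = I), (J \ U).card + (I.card - 1) = b := by
    intro J hJ
    rw [Finset.mem_filter, Finset.mem_powersetCard] at hJ
    obtain ⟨⟨-, hJb⟩, hk, hI⟩ := hJ
    rw [← Finset.card_erase_of_mem hkI, ← hinter J hk hI, Finset.card_sdiff_add_card_inter, hJb]
  unfold outsideChoose
  split_ifs with hb
  · have hcc : (K - U.card).choose (b - (I.card - 1)) =
        ((Uᶜ).powersetCard (b - (I.card - 1))).card := by
      rw [Finset.card_powersetCard, Finset.card_compl, Fintype.card_fin]
    rw [hcc]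
    refine Finset.card_le_card_of_injOn (fun J => J \ U) (fun J hJ => ?_) fun J hJ J' hJ' h => ?_
    · have := hcardJ J hJ
      refine Finset.mem_coe.2 (Finset.mem_powersetCard.2 ⟨fun x hx => ?_, ?_⟩)
      · exact Finset.mem_compl.2 (Finset.mem_sdiff.1 hx).2
      · change (J \ U).card = _
        omega
    · have h1 := (Finset.mem_filter.1 hJ).2
      have h2 := (Finset.mem_filter.1 hJ').2
      have h : J \ U = J' \ U := h
      rw [← Finset.sdiff_union_inter J U, ← Finset.sdiff_union_inter J' U, h,
        hinter J h1.1 h1.2, hinter J' h2.1 h2.2]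
  · rw [Nat.le_zero, Finset.card_eq_zero, Finset.eq_empty_iff_forall_notMem]
    intro J hJ
    have := hcardJ J hJ
    omega

end Scheme

/-! ### Lengths of the phases -/

section Schedule

variable {δ : ℝ} {m : ℕ}

/-- Number of slots for a queue `(U, I)` with `|U| = m` and `|I| = i + 1`, if `c i` equations are
needed for source packets: the packets that user `k ∈ I` has to learn in this queue moreover
include those sent from `(U, J)`, `k ∈ J ⊂ I`, that were received exactly by `I \ J` and possibly
some users of `J` other than `k`. -/
noncomputable def phaseLength (δ : ℝ) (m : ℕ) (c : ℕ → ℝ) (i : ℕ) : ℕ :=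
  ⌈(c i + ∑ j : Fin i, (i.choose j : ℝ) * δ ^ (m - i) * (1 - δ) ^ (i - j.val) *
    phaseLength δ m c j) / (1 - δ ^ (m - i))⌉₊
termination_by i
decreasing_by exact j.isLt

/-- Expected number of slots, in a group `U` of `m` users, that one required equation for each of
the queues `(U, I)` with `|I| = i + 1` takes, including what it entails in larger queues. -/
noncomputable def deliveryCost (δ : ℝ) (m i : ℕ) : ℝ :=
  ∑ k ∈ Finset.range m, ((m - 1 - k).choose i : ℝ) / (1 - δ ^ (k + 1))

lemma one_sub_pow_pos (h0 : 0 ≤ δ) (h1 : δ < 1) {k : ℕ} (hk : k ≠ 0) : 0 < 1 - δ ^ k :=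
  sub_pos.2 (pow_lt_one₀ h0 h1 hk)

lemma deliveryCost_nonneg (h0 : 0 ≤ δ) (h1 : δ < 1) (i : ℕ) : 0 ≤ deliveryCost δ m i :=
  Finset.sum_nonneg fun k _ => div_nonneg (Nat.cast_nonneg _)
    (one_sub_pow_pos h0 h1 (Nat.succ_ne_zero k)).le

lemma le_phaseLength (h0 : 0 ≤ δ) (h1 : δ < 1) (c : ℕ → ℝ) {i : ℕ} (hi : i < m) :
    c i + ∑ j ∈ Finset.range i, (i.choose j : ℝ) * δ ^ (m - i) * (1 - δ) ^ (i - j) *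
      phaseLength δ m c j ≤ (1 - δ ^ (m - i)) * phaseLength δ m c i := by
  have hp := one_sub_pow_pos h0 h1 (show m - i ≠ 0 by omega)
  rw [← div_le_iff₀' hp, ← Fin.sum_univ_eq_sum_range (fun j => (i.choose j : ℝ) * δ ^ (m - i) *
    (1 - δ) ^ (i - j) * phaseLength δ m c j)]
  conv_rhs => rw [phaseLength]
  exact Nat.le_ceil _

lemma phaseLength_le (h0 : 0 ≤ δ) (h1 : δ < 1) (c : ℕ → ℝ) (hc : ∀ i, 0 ≤ c i) {i : ℕ}
    (hi : i < m) :
    (1 - δ ^ (m - i)) * phaseLength δ m c i ≤ c i + 1 + ∑ j ∈ Finset.range i,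
      (i.choose j : ℝ) * δ ^ (m - i) * (1 - δ) ^ (i - j) * phaseLength δ m c j := by
  have hp := one_sub_pow_pos h0 h1 (show m - i ≠ 0 by omega)
  have h1' : 0 ≤ 1 - δ := by linarith
  set X := c i + ∑ j ∈ Finset.range i, (i.choose j : ℝ) * δ ^ (m - i) * (1 - δ) ^ (i - j) *
    phaseLength δ m c j with hX
  have hX0 : 0 ≤ X := add_nonneg (hc i) (Finset.sum_nonneg fun j _ => by positivity)
  have heq : phaseLength δ m c i = ⌈X / (1 - δ ^ (m - i))⌉₊ := by
    rw [phaseLength, hX, ← Fin.sum_univ_eq_sum_range (fun j => (i.choose j : ℝ) * δ ^ (m - i) *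
      (1 - δ) ^ (i - j) * phaseLength δ m c j)]
  have hlt := Nat.ceil_lt_add_one (div_nonneg hX0 hp.le)
  rw [← heq] at hlt
  have h2 := mul_le_mul_of_nonneg_left hlt.le hp.le
  rw [mul_add, mul_div_cancel₀ _ hp.ne', mul_one] at h2
  have : 0 ≤ δ ^ (m - i) := pow_nonneg h0 _
  linarith

lemma sum_range_choose_reflect (m j : ℕ) :
    ∑ k ∈ Finset.range m, (m - 1 - k).choose j = m.choose (j + 1) := by
  rw [Finset.sum_range_reflect (fun r => r.choose j)]
  induction m with
  | zero => simp
  | succ m ih => rw [Finset.sum_range_succ, ih, Nat.choose_succ_succ, add_comm]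

lemma sum_choose_mul_pow (j r k : ℕ) :
    ∑ i ∈ Finset.range (r + k + 1), (i.choose j : ℝ) * (r.choose i) * δ ^ (r + k + 1 - i) *
      (1 - δ) ^ (i - j) = r.choose j * δ ^ (k + 1) := by
  rcases lt_or_ge r j with hrj | hjr
  · rw [Nat.choose_eq_zero_of_lt hrj, Nat.cast_zero, zero_mul]
    refine Finset.sum_eq_zero fun i _ => ?_
    rcases lt_or_ge i j with h | h
    · simp [Nat.choose_eq_zero_of_lt h]
    · simp [Nat.choose_eq_zero_of_lt (hrj.trans_le h)]
  obtain ⟨p, rfl⟩ := Nat.exists_eq_add_of_le hjr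
  have hsub : Finset.Ico j (j + p + 1) ⊆ Finset.range (j + p + k + 1) := by
    intro i hi
    rw [Finset.mem_Ico] at hi
    rw [Finset.mem_range]
    omega
  rw [← Finset.sum_subset hsub, Finset.sum_Ico_eq_sum_range]
  · have hp : j + p + 1 - j = p + 1 := by omega
    have hbin := add_pow (1 - δ) δ p
    rw [sub_add_cancel, one_pow] at hbin
    refine Eq.trans ?_ (mul_one ((j + p).choose j * δ ^ (k + 1) : ℝ))
    refine Eq.trans ?_ (congrArg (((j + p).choose j * δ ^ (k + 1) : ℝ) * ·) hbin.symm)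
    simp only [hp, Finset.mul_sum]
    refine Finset.sum_congr rfl fun i hi => ?_
    have hi' : i ≤ p := Nat.lt_succ_iff.1 (Finset.mem_range.1 hi)
    have hch := Nat.choose_mul (n := j + p) (show j ≤ j + i by omega)
    rw [Nat.add_sub_cancel_left, Nat.add_sub_cancel_left] at hch
    have hch' : ((j + p).choose (j + i) : ℝ) * (j + i).choose j =
        (j + p).choose j * p.choose i := by exact_mod_cast hch
    have he : j + p + k + 1 - (j + i) = (k + 1) + (p - i) := by omega
    rw [he, Nat.add_sub_cancel_left, pow_add, mul_comm ((j + i).choose j : ℝ), hch']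
    ring
  · intro i _ hi
    rw [Finset.mem_Ico, not_and_or] at hi
    rcases hi with h | h
    · simp [Nat.choose_eq_zero_of_lt (not_le.1 h)]
    · simp [Nat.choose_eq_zero_of_lt (show j + p < i by omega)]

/-- One step of the channel: sending one packet from each queue `(U, J)` with `|J| = j + 1` costs
`m.choose (j + 1)` slots, and leaves user `k ∈ J` in need of the packet in the queue `(U, I)`,
`J ⊆ I`, if exactly `I \ J` receive it outside `J` and `k` does not. The sum counts the pairs
`J ⊆ I` for fixed `I` and `k`; by symmetry only cardinalities matter. -/
lemma deliveryCost_recurrence (h0 : 0 ≤ δ) (h1 : δ < 1) (j : ℕ) :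
    deliveryCost δ m j = m.choose (j + 1) + ∑ i ∈ Finset.range m,
      (i.choose j : ℝ) * δ ^ (m - i) * (1 - δ) ^ (i - j) * deliveryCost δ m i := by
  have hswap : ∑ i ∈ Finset.range m,
      (i.choose j : ℝ) * δ ^ (m - i) * (1 - δ) ^ (i - j) * deliveryCost δ m i =
      ∑ k ∈ Finset.range m, ((m - 1 - k).choose j : ℝ) * δ ^ (k + 1) / (1 - δ ^ (k + 1)) := by
    unfold deliveryCost
    simp_rw [Finset.mul_sum]
    rw [Finset.sum_comm]
    refine Finset.sum_congr rfl fun k hk => ?_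
    have hk' := Finset.mem_range.1 hk
    have h := sum_choose_mul_pow (δ := δ) j (m - 1 - k) k
    rw [show m - 1 - k + k + 1 = m by omega] at h
    rw [← h, Finset.sum_div]
    exact Finset.sum_congr rfl fun i _ => by ring
  rw [hswap, ← sum_range_choose_reflect, Nat.cast_sum, ← Finset.sum_add_distrib]
  refine Finset.sum_congr rfl fun k _ => ?_
  have := (one_sub_pow_pos h0 h1 (Nat.succ_ne_zero k)).ne'
  field_simp
  ring

/-- The total length of the phases of a group, by duality between `phaseLength` and
`deliveryCost`. -/
lemma sum_choose_mul_phaseLength_le (h0 : 0 ≤ δ) (h1 : δ < 1) (c : ℕ → ℝ) (hc : ∀ i, 0 ≤ c i) :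
    ∑ j ∈ Finset.range m, (m.choose (j + 1) : ℝ) * phaseLength δ m c j ≤
      ∑ i ∈ Finset.range m, deliveryCost δ m i * (c i + 1) := by
  have hstep : ∀ i ∈ Finset.range m, deliveryCost δ m i * (phaseLength δ m c i -
      ∑ j ∈ Finset.range m, (i.choose j : ℝ) * δ ^ (m - i) * (1 - δ) ^ (i - j) *
        phaseLength δ m c j) ≤ deliveryCost δ m i * (c i + 1) := by
    intro i hi
    have hi' := Finset.mem_range.1 hi
    refine mul_le_mul_of_nonneg_left ?_ (deliveryCost_nonneg h0 h1 i)
    have h := phaseLength_le h0 h1 c hc hi'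
    have hsum : ∑ j ∈ Finset.range m, (i.choose j : ℝ) * δ ^ (m - i) * (1 - δ) ^ (i - j) *
        phaseLength δ m c j = ∑ j ∈ Finset.range i, (i.choose j : ℝ) * δ ^ (m - i) *
          (1 - δ) ^ (i - j) * phaseLength δ m c j + δ ^ (m - i) * phaseLength δ m c i := by
      rw [← Finset.sum_subset (Finset.range_subset_range.2 (show i + 1 ≤ m by omega)),
        Finset.sum_range_succ]
      · simp
      · intro j _ hj
        rw [Nat.choose_eq_zero_of_lt (show i < j by
          have := Finset.mem_range.not.1 hj
          omega)]
        simp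
    rw [hsum]
    linarith
  refine le_trans (le_of_eq ?_) (Finset.sum_le_sum hstep)
  have hdual : ∀ j, (m.choose (j + 1) : ℝ) * phaseLength δ m c j =
      deliveryCost δ m j * phaseLength δ m c j - ∑ i ∈ Finset.range m, deliveryCost δ m i *
        ((i.choose j : ℝ) * δ ^ (m - i) * (1 - δ) ^ (i - j) * phaseLength δ m c j) := by
    intro j
    rw [deliveryCost_recurrence h0 h1 j, add_mul, Finset.sum_mul, add_sub_assoc,
      ← Finset.sum_sub_distrib]
    rw [Finset.sum_eq_zero fun i _ => by ring, add_zero]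
  simp_rw [hdual, mul_sub, Finset.sum_sub_distrib, Finset.mul_sum]
  congr 1
  exact Finset.sum_comm

/-- Vandermonde's identity for the delivery costs of all sub-files of a group. -/
lemma sum_deliveryCost_mul_outsideChoose {K b : ℕ} (hmK : m ≤ K) :
    ∑ i ∈ Finset.range m, deliveryCost δ m i * outsideChoose K b m i =
      ∑ k ∈ Finset.range m, ((K - (k + 1)).choose b : ℝ) / (1 - δ ^ (k + 1)) := by
  unfold deliveryCost
  simp_rw [Finset.sum_mul]
  rw [Finset.sum_comm]
  refine Finset.sum_congr rfl fun k hk => ?_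
  have hk' := Finset.mem_range.1 hk
  simp_rw [div_mul_eq_mul_div]
  rw [← Finset.sum_div]
  congr 1
  have hV := Nat.add_choose_eq (m - 1 - k) (K - m) b
  rw [Finset.Nat.sum_antidiagonal_eq_sum_range_succ_mk,
    show m - 1 - k + (K - m) = K - (k + 1) by omega] at hV
  rw [hV]
  push_cast
  have h1 : ∑ i ∈ Finset.range m, ((m - 1 - k).choose i : ℝ) * outsideChoose K b m i =
      ∑ i ∈ Finset.range (max m (b + 1)), ((m - 1 - k).choose i : ℝ) * outsideChoose K b m i := by
    refine Finset.sum_subset (Finset.range_subset_range.2 (le_max_left _ _)) fun i _ hi => ?_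
    rw [Nat.choose_eq_zero_of_lt (show m - 1 - k < i by
      have := Finset.mem_range.not.1 hi
      omega)]
    simp
  rw [h1, ← Finset.sum_subset (Finset.range_subset_range.2 (le_max_right m (b + 1)))]
  · refine Finset.sum_congr rfl fun i hi => ?_
    rw [outsideChoose, if_pos (Nat.lt_succ_iff.1 (Finset.mem_range.1 hi))]
  · intro i _ hi
    rw [outsideChoose, if_neg (by
      have := Finset.mem_range.not.1 hi
      omega)]
    simp

/-- Slots can be labelled with prescribed multiplicities and in the order of a given rank. -/
lemma exists_labelling {β : Type*} [Fintype β] [DecidableEq β] {n : ℕ} (τ : β → ℕ) (rank : β → ℕ)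
    (hn : ∑ x, τ x = n) :
    ∃ σ : Fin n → β, (∀ x, (Finset.univ.filter fun l => σ l = x).card = τ x) ∧
      ∀ j l, rank (σ j) < rank (σ l) → j < l := by
  have hcard : Fintype.card ((x : β) × Fin (τ x)) = n := by simp [hn]
  let e := (Fintype.equivFinOfCardEq hcard).symm
  let p := Tuple.sort fun l => rank (e l).1
  have hmono : Monotone ((fun l => rank (e l).1) ∘ p) := Tuple.monotone_sort _
  refine ⟨fun l => (e (p l)).1, fun x => ?_, fun j l h => ?_⟩
  · have h : (Finset.univ.filter fun l => (e (p l)).1 = x).card =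
        (Finset.univ.filter fun y : (x : β) × Fin (τ x) => y.1 = x).card :=
      Finset.card_equiv (p.trans e) fun l => by simp
    rw [h]
    have h2 : (Finset.univ.filter fun y : (x : β) × Fin (τ x) => y.1 = x) =
        Finset.univ.map (Function.Embedding.sigmaMk x) := by
      ext ⟨y, c⟩
      simp only [Finset.mem_filter, Finset.mem_univ, true_and, Finset.mem_map,
        Function.Embedding.sigmaMk_apply]
      constructor
      · rintro rfl
        exact ⟨c, rfl⟩
      · rintro ⟨c', hc'⟩
        exact (congrArg Sigma.fst hc').symm
    rw [h2]
    simp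
  · by_contra hlj
    exact absurd (hmono (not_lt.1 hlj)) (not_le.2 h)

end Schedule

/-! ### Schemes of prescribed length -/

section Achievability

open Classical

variable {A : Type*} {K N n b : ℕ} {δ : ℝ}

/-- Number of slots for the queue with label `x`, if the sub-files of user `k` have `g k` packets
and a surplus of `D` equations is wanted. -/
noncomputable def queueLength (δ : ℝ) (b : ℕ) (g : Fin K → ℕ) (D : ℝ)
    (x : Finset (Fin K) × Finset (Fin K)) : ℕ :=
  if x.2 ⊆ x.1 ∧ x.2.Nonempty then
    phaseLength δ x.1.card (fun i => groupSize g x.1 * outsideChoose K b x.1.card i + D)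
      (x.2.card - 1)
  else 0

/-- The queue that a requested packet of user `k` with number `x` in its sub-file `J` joins. -/
def sourceLabel (g : Fin K → ℕ) (k : Fin K) (J : Finset (Fin K)) (x : ℕ) :
    Finset (Fin K) × Finset (Fin K) :=
  (packetGroup g x, insert k (J ∩ packetGroup g x))

lemma card_source_le {h : Fin N → ℕ}
    {place : (i : Fin N) → Fin (K.choose b * h i) → Finset (Fin K)}
    {idx : (i : Fin N) → Fin (K.choose b * h i) → ℕ} (hcard : ∀ i p, (place i p).card = b)
    (hidx : ∀ i p, idx i p < h i)
    (hinj : ∀ i p p', place i p = place i p' → idx i p = idx i p' → p = p')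
    {g : Fin K → ℕ} {d : Fin K → Fin N} (hd : ∀ k, h (d k) = g k) {k : Fin K}
    {u : Finset (Fin K) × Finset (Fin K)} (hk : k ∈ u.2) (hu : u.2 ⊆ u.1) :
    (Finset.univ.filter fun p : (k : Fin K) × Fin (K.choose b * h (d k)) =>
      sourceLabel g p.1 (place (d p.1) p.2) (idx (d p.1) p.2) = u ∧
        ¬ k ∈ place (d p.1) p.2).card ≤
      groupSize g u.1 * outsideChoose K b u.1.card (u.2.card - 1) := by
  have hfst : ∀ p : (k : Fin K) × Fin (K.choose b * h (d k)),
      sourceLabel g p.1 (place (d p.1) p.2) (idx (d p.1) p.2) = u ∧ k ∉ place (d p.1) p.2 →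
        p.1 = k := by
    rintro p ⟨hp, hkp⟩
    rw [← hp] at hk
    exact ((Finset.mem_insert.1 hk).resolve_right fun h => hkp (Finset.mem_inter.1 h).1).symm
  refine le_trans ?_ (Nat.mul_le_mul_left _ (card_place_inter_le (b := b) hk hu))
  unfold groupSize
  rw [← Finset.card_product]
  refine Finset.card_le_card_of_injOn (fun p => (idx (d p.1) p.2, place (d p.1) p.2))
    (fun p hp => ?_) fun p hp p' hp' hpp => ?_
  · have hp' := (Finset.mem_filter.1 hp).2
    have hpk := hfst p hp'
    obtain ⟨k', p⟩ := p
    obtain rfl : k' = k := hpk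
    obtain ⟨hl, hkp⟩ := hp'
    have h1 : packetGroup g (idx (d k') p) = u.1 := congrArg Prod.fst hl
    have h2 : insert k' (place (d k') p ∩ packetGroup g (idx (d k') p)) = u.2 :=
      congrArg Prod.snd hl
    refine Finset.mem_coe.2 (Finset.mem_product.2 ⟨Finset.mem_filter.2 ⟨?_, h1⟩,
      Finset.mem_filter.2 ⟨Finset.mem_powersetCard.2 ⟨Finset.subset_univ _, hcard _ _⟩,
        hkp, h1 ▸ h2⟩⟩)
    rw [Finset.mem_range]
    refine (hidx _ p).trans_le ?_
    rw [hd]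
    exact Finset.le_sup (Finset.mem_univ k')
  · have hpk := hfst p (Finset.mem_filter.1 hp).2
    have hpk' := hfst p' (Finset.mem_filter.1 hp').2
    obtain ⟨k₁, p⟩ := p
    obtain ⟨k₂, p'⟩ := p'
    obtain rfl : k₁ = k := hpk
    obtain rfl : k₂ = k₁ := hpk'
    rw [Prod.mk.injEq] at hpp
    rw [hinj _ p p' hpp.2 hpp.1]

/-- The phases are long enough: on average each queue yields `D` equations more than needed. -/
lemma balance_of_queueLength (h0 : 0 ≤ δ) (h1 : δ < 1) (g : Fin K → ℕ) {D : ℝ}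
    (σ : Fin n → Finset (Fin K) × Finset (Fin K))
    (hσ : ∀ x : Finset (Fin K) × Finset (Fin K), x.2.Nonempty →
      (Finset.univ.filter fun l => σ l = x).card = queueLength δ b g D x)
    {k : Fin K} {u : Finset (Fin K) × Finset (Fin K)} (hk : k ∈ u.2) (hu : u.2 ⊆ u.1) :
    (groupSize g u.1 * outsideChoose K b u.1.card (u.2.card - 1) : ℕ) + D ≤
      ∑ l, ∑ x, slotProb δ x * slotBalance σ k u l x := by
  obtain ⟨U, I⟩ := u
  change k ∈ I at hk
  change I ⊆ U at hu
  have hI : 0 < I.card := Finset.card_pos.2 ⟨k, hk⟩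
  have hIU := Finset.card_le_card hu
  set m := U.card with hm
  set i := I.card - 1 with hi
  have him : i < m := by omega
  have hexp : (U \ I).card + 1 = m - i := by
    rw [Finset.card_sdiff_of_subset hu]
    omega
  set c : ℕ → ℝ := fun i => groupSize g U * outsideChoose K b m i + D with hc
  let F : Finset (Fin K) × Finset (Fin K) → ℝ := fun x =>
    (if x = (U, I) then 1 - δ ^ (m - i) else 0) -
        if x.1 = U ∧ k ∈ x.2 ∧ x.2 ⊂ I then
          (1 - δ) ^ (I \ x.2).card * δ ^ (m - i) else 0
  have hF0 : ∀ x, ¬ x.2.Nonempty → F x = 0 := by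
    intro x hx
    have h1 : ¬ x = (U, I) := by
      rintro rfl
      exact hx ⟨k, hk⟩
    have h2 : ¬ (x.1 = U ∧ k ∈ x.2 ∧ x.2 ⊂ I) := fun h => hx ⟨k, h.2.1⟩
    simp only [F, if_neg h1, if_neg h2, sub_zero]
  have hsum : ∑ l, ∑ x, slotProb δ x * slotBalance σ k (U, I) l x =
      ∑ x, (queueLength δ b g D x : ℝ) * F x := by
    have h : ∀ l, ∑ x, slotProb δ x * slotBalance σ k (U, I) l x = F (σ l) := by
      intro l
      rw [sum_slotProb_mul_slotBalance σ k (U, I) hk hu l]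
      simp only [F, hexp]
    rw [Finset.sum_congr rfl fun l _ => h l, ← Finset.sum_fiberwise' Finset.univ σ F]
    refine Finset.sum_congr rfl fun x _ => ?_
    rw [Finset.sum_const, nsmul_eq_mul]
    by_cases hx : x.2.Nonempty
    · rw [hσ x hx]
    · rw [hF0 x hx, mul_zero, mul_zero]
  have hpos : ∑ x, (queueLength δ b g D x : ℝ) * (if x = (U, I) then 1 - δ ^ (m - i) else 0) =
      (1 - δ ^ (m - i)) * phaseLength δ m c i := by
    rw [Finset.sum_eq_single (U, I) (fun x _ hx => by rw [if_neg hx, mul_zero])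
      (fun h => absurd (Finset.mem_univ _) h), if_pos rfl, mul_comm]
    rw [queueLength, if_pos ⟨hu, ⟨k, hk⟩⟩]
  have hneg : ∑ x : Finset (Fin K) × Finset (Fin K), (queueLength δ b g D x : ℝ) *
      (if x.1 = U ∧ k ∈ x.2 ∧ x.2 ⊂ I then (1 - δ) ^ (I \ x.2).card * δ ^ (m - i) else 0) =
      ∑ j ∈ Finset.range i, (i.choose j : ℝ) * δ ^ (m - i) * (1 - δ) ^ (i - j) *
        phaseLength δ m c j := by
    let φ : ℕ → ℝ := fun j => if j < i then δ ^ (m - i) * (1 - δ) ^ (i - j) *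
        phaseLength δ m c j else 0
    have hpow := Finset.sum_powerset_apply_card φ (x := I.erase k)
    have hcard : (I.erase k).card = i := Finset.card_erase_of_mem hk
    rw [hcard, Finset.sum_range_succ] at hpow
    have hrange : ∑ j ∈ Finset.range i, (i.choose j : ℝ) * δ ^ (m - i) * (1 - δ) ^ (i - j) *
        phaseLength δ m c j = ∑ J ∈ (I.erase k).powerset, φ J.card := by
      rw [hpow]
      simp only [φ, lt_irrefl, if_false, smul_zero, add_zero]
      refine Finset.sum_congr rfl fun j hj => ?_
      rw [if_pos (Finset.mem_range.1 hj), nsmul_eq_mul]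
      ring
    rw [hrange, ← Finset.sum_subset (Finset.subset_univ
      ((I.erase k).powerset.image fun J => (U, insert k J)))]
    · rw [Finset.sum_image]
      · refine Finset.sum_congr rfl fun J hJ => ?_
        rw [Finset.mem_powerset] at hJ
        have hkJ : k ∉ J := fun h => Finset.notMem_erase k I (hJ h)
        have hins : insert k J ⊆ I :=
          Finset.insert_subset hk (hJ.trans (Finset.erase_subset k I))
        have hJi := Finset.card_le_card hJ
        rw [hcard] at hJi
        have hcJ : (insert k J).card = J.card + 1 := Finset.card_insert_of_notMem hkJ
        by_cases hlt : J.card < i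
        · have hss : insert k J ⊂ I := hins.ssubset_of_ne fun h => by
            rw [h] at hcJ
            omega
          have hsd : (I \ insert k J).card = i - J.card := by
            rw [Finset.card_sdiff_of_subset hins]
            omega
          have hql : queueLength δ b g D (U, insert k J) = phaseLength δ m c J.card := by
            rw [queueLength, if_pos ⟨hins.trans hu, Finset.insert_nonempty _ _⟩]
            simp only [hcJ, Nat.add_sub_cancel]
            rfl
          rw [if_pos ⟨rfl, Finset.mem_insert_self k J, hss⟩, hql, hsd]
          simp only [φ, if_pos hlt]
          ring
        · have hns : ¬ insert k J ⊂ I := fun h => by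
            have := Finset.card_lt_card h
            omega
          rw [if_neg fun h => hns h.2.2]
          simp only [φ, if_neg hlt, mul_zero]
      · intro J hJ J' hJ' h
        have hJ := Finset.mem_powerset.1 (Finset.mem_coe.1 hJ)
        have hJ' := Finset.mem_powerset.1 (Finset.mem_coe.1 hJ')
        have h2 : insert k J = insert k J' := congrArg Prod.snd h
        rw [← Finset.erase_insert fun h => Finset.notMem_erase k I (hJ h), h2,
          Finset.erase_insert fun h => Finset.notMem_erase k I (hJ' h)]
    · rintro ⟨U', J⟩ - hx
      rw [if_neg, mul_zero]
      rintro ⟨rfl, hkJ, hss⟩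
      exact hx (Finset.mem_image.2 ⟨J.erase k,
        Finset.mem_powerset.2 (Finset.erase_subset_erase k hss.1), by
          rw [Finset.insert_erase hkJ]⟩)
  have hle := le_phaseLength h0 h1 c him
  rw [hsum]
  simp only [F, mul_sub, Finset.sum_sub_distrib]
  rw [hpos, hneg]
  have hci : c i = (groupSize g U * outsideChoose K b m i : ℕ) + D := by
    rw [hc]
    push_cast
    rfl
  linarith

/-- Enough slots for all queues give a scheme with exponentially small error probability. -/
theorem exists_scheme_of_sum_queueLength_le [Field A] [Fintype A] (h0 : 0 ≤ δ) (h1 : δ < 1) {M : ℝ}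
    (hK : 0 < K) (hbK : b ≤ K) (hb : (b : ℝ) = M * K / N) (h : Fin N → ℕ) (g : Fin K → ℕ)
    {s D : ℝ} (s0 : 0 ≤ s) (s2 : s ≤ Real.log 2) (hn : ∑ x, queueLength δ b g D x ≤ n) :
    ∃ C : CachingScheme A K N (fun _ => M) (fun i => K.choose b * h i) n, C.IsCentralized b ∧
      ∀ d : Fin K → Fin N, (∀ k, h (d k) = g k) → ∀ k, C.errorProb (fun _ => δ) d k ≤
        Fintype.card (Fin K × Finset (Fin K) × Finset (Fin K)) *
          Real.exp (-s * D + n * s ^ 2) := by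
  obtain ⟨place, idx, hcard, hidx, hcount, hinj⟩ := exists_placement (K := K) b h
  -- Slots that no queue needs carry the label `(∅, ∅)`.
  obtain ⟨σ, hσcard, hσlt⟩ := exists_labelling (n := n)
    (fun x : Finset (Fin K) × Finset (Fin K) => queueLength δ b g D x +
      if x = (∅, ∅) then n - ∑ x, queueLength δ b g D x else 0) (fun x => x.2.card) (by
        rw [Finset.sum_add_distrib, Finset.sum_ite_eq']
        simp only [Finset.mem_univ, if_true]
        omega)
  have hσ : ∀ x : Finset (Fin K) × Finset (Fin K), x.2.Nonempty →
      (Finset.univ.filter fun l => σ l = x).card = queueLength δ b g D x := by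
    intro x hx
    rw [hσcard, if_neg, add_zero]
    rintro rfl
    exact Finset.not_nonempty_empty hx
  have hord : ∀ j l, (σ j).1 = (σ l).1 → (σ j).2 ⊂ (σ l).2 → j < l :=
    fun j l _ hjl => hσlt j l (Finset.card_lt_card hjl)
  have hcode : ∀ d : Fin K → Fin N, ∃ (enc : (l : Fin n) →
      ((k : Fin K) → Fin (K.choose b * h (d k)) → A) → StateSeq K l.val → A)
      (bad : Fin K → StateSeq K n → Prop),
      (∀ k S, ¬ bad k S → ∀ W W' : Library A fun i => K.choose b * h i,
        (∀ i p, k ∈ place i p → W i p = W' i p) →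
        (∀ l, k ∈ S l → enc l (fun k => W (d k)) (pastStates S l) =
          enc l (fun k => W' (d k)) (pastStates S l)) → W (d k) = W' (d k)) ∧
      ((∀ k, h (d k) = g k) → ∀ k,
        ∑ S : StateSeq K n, (if bad k S then stateProb (fun _ => δ) S else 0) ≤
          Fintype.card (Fin K × Finset (Fin K) × Finset (Fin K)) *
            Real.exp (-s * D + n * s ^ 2)) := by
    intro d
    by_cases hd : ∀ k, h (d k) = g k
    swap
    · exact ⟨fun _ _ _ => 0, fun _ _ => True, fun k S hS => absurd trivial hS,
        fun hd' => absurd hd' hd⟩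
    obtain ⟨lab, hlabel⟩ : ∃ lab : (k : Fin K) × Fin (K.choose b * h (d k)) →
        Finset (Fin K) × Finset (Fin K),
        ∀ p, lab p = sourceLabel g p.1 (place (d p.1) p.2) (idx (d p.1) p.2) :=
      ⟨_, fun _ => rfl⟩
    obtain ⟨known, hknown⟩ : ∃ known : Fin K → (k : Fin K) × Fin (K.choose b * h (d k)) → Prop,
        ∀ k p, known k p ↔ k ∈ place (d p.1) p.2 := ⟨_, fun _ _ => Iff.rfl⟩
    obtain ⟨a, ha⟩ := exists_coefficients (A := A) h0 h1 lab known σ s0 s2 (D := D)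
      fun k u hk hu => by
        refine le_trans (add_le_add_left (Nat.cast_le.2 ?_) D)
          (balance_of_queueLength h0 h1 g σ hσ hk hu)
        refine le_trans (Finset.card_le_card fun p hp => ?_)
          (card_source_le hcard hidx hinj hd hk hu)
        rw [Finset.mem_filter, hlabel, hknown] at hp
        exact Finset.mem_filter.2 hp
    have hlab : ∀ p, (lab p).2 ⊆ (lab p).1 := by
      rintro ⟨k, p⟩
      rw [hlabel]
      refine Finset.insert_subset (Finset.mem_filter.2 ⟨Finset.mem_univ _, ?_⟩)
        Finset.inter_subset_right
      exact (hidx _ p).trans_eq (hd k)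
    refine ⟨fun l w S' => codeword lab σ a (fun p => w p.1 p.2)
        (fun j => if hj : j.val < l.val then S' ⟨j.val, hj⟩ else ∅) l,
      fun k S => ∃ u : Finset (Fin K) × Finset (Fin K), k ∈ u.2 ∧ u.2 ⊆ u.1 ∧
        ¬ FullColumnRankOn (equationSlots σ S k u) (unknownItems lab known σ S k u) a,
      fun k S hS W W' hc hr => ?_, fun _ k =>
        (Finset.sum_le_sum fun S _ => le_of_eq (by congr)).trans (ha k)⟩
    have hpast : ∀ (w : (k : Fin K) × Fin (K.choose b * h (d k)) → A) l,
        codeword lab σ a w (fun j => if hj : j.val < l.val then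
          pastStates S l ⟨j.val, hj⟩ else ∅) l = codeword lab σ a w S l := by
      intro w l
      refine codeword_congr lab σ a w _ _ l fun j hj => ?_
      rw [dif_pos (show j.val < l.val from hj)]
      rfl
    funext p
    refine eq_of_fullColumnRankOn (lab := lab) (known := known) (a := a) (S := S) (k := k) hord
      hlab
      (fun u hk hu => ?_) (W := fun p => W (d p.1) p.2) (W' := fun p => W' (d p.1) p.2)
      (fun p hp => hc _ _ ((hknown k p).1 hp)) (fun l hl => ?_) ⟨k, p⟩
      (by rw [hlabel]; exact Finset.mem_insert_self _ _)
    · by_contra hnot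
      exact hS ⟨u, hk, hu, hnot⟩
    · have := hr l hl
      simp only [hpast] at this
      exact this
  choose enc bad hdec hbad using hcode
  obtain ⟨C, hC, herr⟩ := exists_scheme (A := A) (δ := δ) (M := M) h0 h1 hK hbK hb place hcard
    hcount enc bad hdec
  exact ⟨C, hC, fun d hd k => (herr d k).trans (hbad d hd k)⟩

end Achievability

/-! ### Total number of slots -/

section Total

open Classical

variable {K b : ℕ} {δ : ℝ}

/-- The slots spent on the surplus of equations, per equation. -/
noncomputable def surplusCost (K : ℕ) (δ : ℝ) : ℝ :=
  ∑ U : Finset (Fin K), ∑ i ∈ Finset.range U.card, deliveryCost δ U.card i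

lemma surplusCost_nonneg (h0 : 0 ≤ δ) (h1 : δ < 1) : 0 ≤ surplusCost K δ :=
  Finset.sum_nonneg fun _ _ => Finset.sum_nonneg fun i _ => deliveryCost_nonneg h0 h1 i

lemma sum_queueLength_le (h0 : 0 ≤ δ) (h1 : δ < 1) (b : ℕ) (g : Fin K → ℕ) {D : ℝ} (hD : 0 ≤ D) :
    ((∑ x, queueLength δ b g D x : ℕ) : ℝ) ≤
      ∑ U : Finset (Fin K), groupSize g U * ∑ k ∈ Finset.range U.card,
        ((K - (k + 1)).choose b : ℝ) / (1 - δ ^ (k + 1)) + (D + 1) * surplusCost K δ := by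
  have hU : ∀ U : Finset (Fin K), ((∑ I, queueLength δ b g D (U, I) : ℕ) : ℝ) ≤
      groupSize g U * ∑ k ∈ Finset.range U.card,
        ((K - (k + 1)).choose b : ℝ) / (1 - δ ^ (k + 1)) +
      (D + 1) * ∑ i ∈ Finset.range U.card, deliveryCost δ U.card i := by
    intro U
    set c : ℕ → ℝ := fun i => groupSize g U * outsideChoose K b U.card i + D with hc
    let φ : ℕ → ℕ := fun j => if j = 0 then 0 else phaseLength δ U.card c (j - 1)
    have h1' : ∑ I, queueLength δ b g D (U, I) = ∑ I ∈ U.powerset, φ I.card := by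
      rw [← Finset.sum_subset (Finset.subset_univ U.powerset)]
      · refine Finset.sum_congr rfl fun I hI => ?_
        rw [Finset.mem_powerset] at hI
        rcases I.eq_empty_or_nonempty with rfl | hne
        · simp [queueLength, φ]
        · rw [queueLength, if_pos ⟨hI, hne⟩]
          simp only [φ, if_neg hne.card_pos.ne']
          rfl
      · intro I _ hI
        rw [queueLength, if_neg fun h => hI (Finset.mem_powerset.2 h.1)]
    have hmK : U.card ≤ K := by simpa using Finset.card_le_univ U
    have hcn : ∀ i, 0 ≤ c i := fun i => by positivity
    have h2 := sum_choose_mul_phaseLength_le (m := U.card) h0 h1 c hcn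
    rw [h1', Finset.sum_powerset_apply_card, Finset.sum_range_succ']
    simp only [φ, Nat.succ_ne_zero, if_false, if_true, smul_eq_mul, mul_zero, add_zero,
      Nat.add_sub_cancel]
    push_cast
    refine h2.trans (le_of_eq ?_)
    rw [← sum_deliveryCost_mul_outsideChoose hmK, Finset.mul_sum, Finset.mul_sum,
      ← Finset.sum_add_distrib]
    exact Finset.sum_congr rfl fun i _ => by rw [hc]; ring
  rw [Fintype.sum_prod_type, Nat.cast_sum, surplusCost, Finset.mul_sum, ← Finset.sum_add_distrib]
  exact Finset.sum_le_sum fun U _ => hU U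

/-- In an order of the users by decreasing sub-file size, each packet group consists of the first
users. -/
lemma exists_perm_lt_iff (g : Fin K → ℕ) :
    ∃ π : Equiv.Perm (Fin K), ∀ x (j : Fin K), x < g (π j) ↔ j.val < (packetGroup g x).card := by
  let π := Tuple.sort fun k => OrderDual.toDual (g k)
  have hmono : ∀ i j, i ≤ j → g (π j) ≤ g (π i) := fun i j hij =>
    OrderDual.toDual_le_toDual.1 (Tuple.monotone_sort (fun k => OrderDual.toDual (g k)) hij)
  refine ⟨π, fun x j => ?_⟩
  have hcard : (packetGroup g x).card = (Finset.univ.filter fun j => x < g (π j)).card :=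
    (Finset.card_equiv π fun j => by simp [packetGroup]).symm
  rw [hcard]
  constructor
  · intro hj
    have hsub : Finset.Iic j ⊆ Finset.univ.filter fun j => x < g (π j) := fun i hi =>
      Finset.mem_filter.2 ⟨Finset.mem_univ _, hj.trans_le (hmono i j (Finset.mem_Iic.1 hi))⟩
    have := Finset.card_le_card hsub
    rw [Fin.card_Iic] at this
    omega
  · intro hj
    by_contra hx
    have hsub : (Finset.univ.filter fun j => x < g (π j)) ⊆ Finset.Iio j := fun i hi => by
      rw [Finset.mem_Iio]
      by_contra hij
      exact hx ((Finset.mem_filter.1 hi).2.trans_le (hmono j i (not_lt.1 hij)))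
    have := Finset.card_le_card hsub
    rw [Fin.card_Iio] at this
    omega

lemma exists_perm_sum_groupSize_eq (b : ℕ) (g : Fin K → ℕ) :
    ∃ π : Equiv.Perm (Fin K),
      ∑ U : Finset (Fin K), groupSize g U * ∑ k ∈ Finset.range U.card,
        ((K - (k + 1)).choose b : ℝ) / (1 - δ ^ (k + 1)) =
      ∑ j : Fin (K - b), ((K - (j.val + 1)).choose b : ℝ) / (1 - δ ^ (j.val + 1)) *
        g (π (Fin.castLE (Nat.sub_le K b) j)) := by
  obtain ⟨π, hπ⟩ := exists_perm_lt_iff g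
  refine ⟨π, ?_⟩
  let w : ℕ → ℝ := fun k => ((K - (k + 1)).choose b : ℝ) / (1 - δ ^ (k + 1))
  have hle : ∀ k, g k ≤ Finset.univ.sup g := fun k => Finset.le_sup (Finset.mem_univ k)
  calc _ = ∑ U : Finset (Fin K), ∑ x ∈ (Finset.range (Finset.univ.sup g)).filter
        (fun x => packetGroup g x = U), ∑ k ∈ Finset.range U.card, w k := by
        refine Finset.sum_congr rfl fun U _ => ?_
        rw [Finset.sum_const, nsmul_eq_mul]
        rfl
    _ = ∑ x ∈ Finset.range (Finset.univ.sup g),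
        ∑ k ∈ Finset.range (packetGroup g x).card, w k :=
        Finset.sum_fiberwise' _ _ fun U : Finset (Fin K) => ∑ k ∈ Finset.range U.card, w k
    _ = ∑ x ∈ Finset.range (Finset.univ.sup g), ∑ j : Fin K,
        if x < g (π j) then w j else 0 := by
        refine Finset.sum_congr rfl fun x _ => ?_
        have hc : (packetGroup g x).card ≤ K := by
          simpa using Finset.card_le_univ (packetGroup g x)
        simp_rw [hπ]
        rw [Fin.sum_univ_eq_sum_range (fun k => if k < (packetGroup g x).card then w k else 0),
          ← Finset.sum_filter]
        refine Finset.sum_congr ?_ fun _ _ => rfl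
        ext k
        simp only [Finset.mem_range, Finset.mem_filter]
        omega
    _ = ∑ j : Fin K, w j * g (π j) := by
        rw [Finset.sum_comm]
        refine Finset.sum_congr rfl fun j _ => ?_
        rw [← Finset.sum_filter, Finset.sum_const, nsmul_eq_mul, mul_comm]
        have : (Finset.range (Finset.univ.sup g)).filter (fun x => x < g (π j)) =
            Finset.range (g (π j)) := by
          ext x
          have := hle (π j)
          simp only [Finset.mem_range, Finset.mem_filter]
          omega
        rw [this, Finset.card_range]
    _ = _ := by
        rw [← Finset.sum_subset (Finset.subset_univ
          (Finset.univ.map (Fin.castLEEmb (Nat.sub_le K b)))), Finset.sum_map]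
        · rfl
        · intro j _ hj
          have hjb : K - b ≤ j.val := by
            by_contra hlt
            exact hj (Finset.mem_map.2 ⟨⟨j.val, not_le.1 hlt⟩, Finset.mem_univ _, rfl⟩)
          have : w j.val = 0 := by
            have := j.isLt
            simp only [w]
            rw [Nat.choose_eq_zero_of_lt (by omega), Nat.cast_zero, zero_div]
          rw [this, zero_mul]

/-- Achievability: with a proportional surplus of slots over the bounds for all orders of the
users, the error probability vanishes for large sub-files. -/
theorem exists_reliable_scheme (A : Type*) [Field A] [Fintype A] {N : ℕ} {M : ℝ} (h0 : 0 ≤ δ)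
    (h1 : δ < 1) (hK : 0 < K) (hbK : b ≤ K) (hb : (b : ℝ) = M * K / N) {ν κ ε : ℝ} (hν : 0 < ν)
    (hκ : 0 < κ) (hε : 0 < ε) :
    ∃ L₀ : ℕ, ∀ L, L₀ ≤ L → ∀ (n : ℕ) (g : Fin K → ℕ) (h : Fin N → ℕ), (n : ℝ) ≤ ν * L →
      (∀ π : Equiv.Perm (Fin K), ∑ j : Fin (K - b),
        ((K - (j.val + 1)).choose b : ℝ) / (1 - δ ^ (j.val + 1)) *
          g (π (Fin.castLE (Nat.sub_le K b) j)) + κ * L ≤ n) →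
      ∃ C : CachingScheme A K N (fun _ => M) (fun i => K.choose b * h i) n, C.IsCentralized b ∧
        C.IsReliable (fun _ => δ) (fun k => K.choose b * g k) ε := by
  have hc0 := surplusCost_nonneg (K := K) h0 h1
  set c := surplusCost K δ with hc
  set γ := κ / (2 * (c + 1)) with hγ
  have hγ0 : 0 < γ := by positivity
  -- With this rate the surplus outweighs the quadratic term of Chernoff's bound twice.
  set s := min (γ / (2 * ν)) (Real.log 2) with hs
  have hs0 : 0 < s := lt_min (by positivity) (Real.log_pos one_lt_two)
  set B : ℝ := (Fintype.card (Fin K × Finset (Fin K) × Finset (Fin K)) : ℝ) with hB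
  have htend : Filter.Tendsto (fun L : ℕ => B * Real.exp (-(s * γ / 2 * L))) Filter.atTop
      (nhds (B * 0)) :=
    (Real.tendsto_exp_neg_atTop_nhds_zero.comp (tendsto_natCast_atTop_atTop.const_mul_atTop
      (show 0 < s * γ / 2 by positivity))).const_mul B
  rw [mul_zero] at htend
  obtain ⟨L₁, hL₁⟩ := Filter.eventually_atTop.1 (htend.eventually (gt_mem_nhds hε))
  refine ⟨max L₁ ⌈2 * c / κ⌉₊, fun L hL n g h hn hπ => ?_⟩
  have hL2 : 2 * c / κ ≤ L :=
    (Nat.le_ceil _).trans (by exact_mod_cast (le_max_right _ _).trans hL)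
  have hsum : ((∑ x, queueLength δ b g (γ * L) x : ℕ) : ℝ) ≤ n := by
    refine (sum_queueLength_le h0 h1 b g (by positivity)).trans ?_
    obtain ⟨π, hπ'⟩ := exists_perm_sum_groupSize_eq (δ := δ) b g
    rw [hπ']
    refine le_trans (add_le_add_right ?_ _) (hπ π)
    have e1 : γ * c ≤ κ / 2 := by
      rw [hγ, div_mul_eq_mul_div, div_le_div_iff₀ (by positivity) two_pos]
      nlinarith
    rw [div_le_iff₀ hκ] at hL2
    have e2 : γ * c * L ≤ κ / 2 * L := mul_le_mul_of_nonneg_right e1 (Nat.cast_nonneg L)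
    nlinarith
  obtain ⟨C, hC, herr⟩ := exists_scheme_of_sum_queueLength_le (A := A) (M := M) h0 h1 hK hbK hb h g
    hs0.le (min_le_right _ _) (by exact_mod_cast hsum)
  refine ⟨C, hC, fun d _ hd k => lt_of_le_of_lt (herr d (fun k => ?_) k)
    (lt_of_le_of_lt ?_ (hL₁ L ((le_max_left _ _).trans hL)))⟩
  · exact Nat.eq_of_mul_eq_mul_left (Nat.choose_pos hbK) (hd k)
  · refine mul_le_mul_of_nonneg_left (Real.exp_le_exp.2 ?_) (Nat.cast_nonneg _)
    have e1 : s * ν ≤ γ / 2 := by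
      have := min_le_left (γ / (2 * ν)) (Real.log 2)
      rw [← hs, le_div_iff₀ (by positivity)] at this
      linarith
    have e2 : n * s ^ 2 ≤ ν * L * s ^ 2 := mul_le_mul_of_nonneg_right hn (sq_nonneg s)
    have e3 : (s * ν) * (s * L) ≤ γ / 2 * (s * L) :=
      mul_le_mul_of_nonneg_right e1 (by positivity)
    nlinarith

end Total

/-! ### The converse for small error probability -/

section SmallError

variable {K b : ℕ} {δ : ℝ}

lemma weight_ge (h0 : 0 ≤ δ) (h1 : δ < 1) (hbK : b ≤ K) (j : Fin (K - b)) :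
    1 / (K.choose b : ℝ) ≤
      (((K - (j.val + 1)).choose b : ℝ) / (K.choose b : ℝ)) / (1 - δ ^ (j.val + 1)) := by
  have hch : (0 : ℝ) < K.choose b := by exact_mod_cast Nat.choose_pos hbK
  have hc1 : (1 : ℝ) ≤ (K - (j.val + 1)).choose b := by
    exact_mod_cast Nat.choose_pos (by omega)
  have hp := one_sub_pow_pos h0 h1 (Nat.succ_ne_zero j.val)
  have hp1 : 0 ≤ δ ^ (j.val + 1) := pow_nonneg h0 _
  rw [le_div_iff₀ hp, div_mul_eq_mul_div, one_mul]
  exact div_le_div_of_nonneg_right (by simp only [Nat.succ_eq_add_one] at *; linarith) hch.le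

/-- For small error probability the delivery takes almost as many slots as without errors,
uniformly in the file sizes. -/
theorem exists_error_slots_lower_bound (A : Type*) [Field A] [Fintype A] (N : ℕ) (M : Fin K → ℝ)
    (h0 : 0 ≤ δ) (h1 : δ < 1) (hbK : b ≤ K) {η : ℝ} (hη : 0 < η) :
    ∃ ε₀ : ℝ, 0 < ε₀ ∧ ∀ (Fs : Fin N → ℕ) (n : ℕ) (C : CachingScheme A K N M Fs n),
      C.IsCentralized b → ∀ d : Fin K → Fin N, Function.Injective d → (∀ k, 0 < Fs (d k)) →
      (∀ k, C.errorProb (fun _ => δ) d k ≤ ε₀) → ∀ π : Equiv.Perm (Fin K),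
      (1 - η) * ∑ j : Fin (K - b),
        (((K - (j.val + 1)).choose b : ℝ) / (K.choose b : ℝ)) / (1 - δ ^ (j.val + 1)) *
          Fs (d (π (Fin.castLE (Nat.sub_le K b) j))) ≤ n := by
  have hq : 0 < Real.log (Fintype.card A) :=
    Real.log_pos (by exact_mod_cast Fintype.one_lt_card (α := A))
  set q := Real.log (Fintype.card A) with hqdef
  have hch : (0 : ℝ) < K.choose b := by exact_mod_cast Nat.choose_pos hbK
  -- `e` bounds Fano's loss per packet; it is to be at most `η` times every weight.
  set e := η * (1 - δ) / K.choose b with he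
  have he0 : 0 < e := div_pos (mul_pos hη (by linarith)) hch
  set t := 1 - Real.exp (-(e * q / 2)) with ht
  have ht1 : t < 1 := by
    have := Real.exp_pos (-(e * q / 2))
    linarith
  have ht0 : 0 < t := by
    have : Real.exp (-(e * q / 2)) < 1 := Real.exp_lt_one_iff.2 (by
      have : 0 < e * q := by positivity
      linarith)
    linarith
  have hlogt : -Real.log (1 - t) = e * q / 2 := by
    rw [ht, sub_sub_cancel, Real.log_exp, neg_neg]
  have hnegt := Real.log_neg ht0 ht1
  refine ⟨e * q / 2 / (q - Real.log t), div_pos (by positivity) (by linarith),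
    fun Fs n C hC d hd hpos herr π => ?_⟩
  have hlow := slots_lower_bound h0 h1 C hbK hC d hd π ht0 ht1 herr
  refine le_of_mul_le_mul_right (le_trans ?_ hlow) hq
  rw [Finset.mul_sum, Finset.sum_mul]
  refine Finset.sum_le_sum fun j _ => ?_
  have hwge := weight_ge h0 h1 hbK j
  set G : ℝ := (Fs (d (π (Fin.castLE (Nat.sub_le K b) j))) : ℝ) with hG
  have hG1 : 1 ≤ G := Nat.one_le_cast.2 (hpos _)
  set p := 1 - δ ^ (j.val + 1) with hp
  have hp0 : 0 < p := one_sub_pow_pos h0 h1 (Nat.succ_ne_zero j.val)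
  have hpδ : 1 - δ ≤ p := by
    have : δ ^ (j.val + 1) ≤ δ := pow_le_of_le_one h0 h1.le (Nat.succ_ne_zero _)
    linarith
  set v : ℝ := ((K - (j.val + 1)).choose b : ℝ) / (K.choose b : ℝ) with hv
  set ε₀ := e * q / 2 / (q - Real.log t) with hε₀
  have hε : ε₀ * (q - Real.log t) = e * q / 2 := div_mul_cancel₀ _ (by linarith : q - Real.log t ≠ 0)
  have hε0 : 0 < ε₀ := div_pos (by positivity) (by linarith)
  rw [hlogt]
  -- Fano's loss is at most `e * q * G` as `1 ≤ G`.
  have hloss : e * q / 2 + ε₀ * (G * q - Real.log t) ≤ e * q * G := by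
    have e1 : G * q - Real.log t ≤ G * (q - Real.log t) := by nlinarith
    have e2 := mul_le_mul_of_nonneg_left e1 hε0.le
    have e3 : ε₀ * (G * (q - Real.log t)) = G * (e * q / 2) := by rw [← hε]; ring
    have : 0 < e * q := by positivity
    nlinarith
  have hwe : e ≤ η * v := by
    have e1 : (1 - δ) / K.choose b ≤ v := by
      rw [le_div_iff₀ hp0] at hwge
      refine le_trans ?_ hwge
      rw [div_mul_eq_mul_div, one_mul]
      exact div_le_div_of_nonneg_right hpδ hch.le
    rw [he, mul_div_assoc]
    exact mul_le_mul_of_nonneg_left e1 hη.le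
  rw [show (1 - η) * (v / p * G) * q = ((1 - η) * v * (G * q)) / p by ring]
  refine div_le_div_of_nonneg_right ?_ hp0.le
  have hGq : 0 < G * q := by positivity
  have := mul_le_mul_of_nonneg_right hwe hGq.le
  linarith

end SmallError

/-! ### Rate region and delivery time -/

section Region

variable {K b : ℕ} {δ : ℝ}

lemma weight_mul_choose (hbK : b ≤ K) (x y : ℝ) :
    x / (K.choose b : ℝ) / y * K.choose b = x / y := by
  have hch : (K.choose b : ℝ) ≠ 0 := by exact_mod_cast (Nat.choose_pos hbK).ne'
  rw [div_right_comm, div_mul_cancel₀ _ hch]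

/-- The converse part of the rate region. -/
lemma sum_le_one_of_isAchievable (A : Type*) [Field A] [Fintype A] {N : ℕ} {M : Fin K → ℝ}
    (h0 : 0 ≤ δ) (h1 : δ < 1) (hbK : b ≤ K) {R : Fin K → ℝ} (hR : ∀ k, 0 ≤ R k)
    (hach : IsAchievable A K N M (fun _ => δ) b R) (π : Equiv.Perm (Fin K)) :
    ∑ j : Fin (K - b),
      (((K - (j.val + 1)).choose b : ℝ) / (K.choose b : ℝ)) / (1 - δ ^ (j.val + 1)) *
        R (π (Fin.castLE (Nat.sub_le K b) j)) ≤ 1 := by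
  by_contra! hS
  set w : Fin (K - b) → ℝ := fun j =>
    (((K - (j.val + 1)).choose b : ℝ) / (K.choose b : ℝ)) / (1 - δ ^ (j.val + 1)) with hw
  have hw0 : ∀ j, 0 ≤ w j := fun j => le_trans (by positivity) (weight_ge h0 h1 hbK j)
  set s := ∑ j, w j * R (π (Fin.castLE (Nat.sub_le K b) j)) with hs
  have hs0 : 0 < s := one_pos.trans hS
  obtain ⟨ε₀, hε₀, hlow⟩ := exists_error_slots_lower_bound A N M h0 h1 hbK
    (show 0 < (s - 1) / (2 * s) from div_pos (by linarith) (by linarith))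
  obtain ⟨Fs, G, n, C, hn, ⟨d, hd, hdG⟩, hC, hrel, hRG⟩ := hach ε₀ hε₀
  have hn' : (0 : ℝ) < n := by exact_mod_cast hn
  have hRG' : ∀ k, R k * n < Fs (d k) := fun k => by
    rw [hdG]
    exact (lt_div_iff₀ hn').1 (hRG k)
  have h := hlow Fs n C hC d hd
    (fun k => by exact_mod_cast (mul_nonneg (hR k) hn'.le).trans_lt (hRG' k))
    (fun k => (hrel d hd hdG k).le) π
  have hη : 1 - (s - 1) / (2 * s) = (s + 1) / (2 * s) := by
    field_simp
    ring
  have hsn : s * n ≤ ∑ j, w j * Fs (d (π (Fin.castLE (Nat.sub_le K b) j))) := by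
    rw [hs, Finset.sum_mul]
    refine Finset.sum_le_sum fun j _ => ?_
    rw [mul_assoc]
    exact mul_le_mul_of_nonneg_left (hRG' _).le (hw0 j)
  rw [hη] at h
  have h2 := (mul_le_mul_of_nonneg_left hsn (show 0 ≤ (s + 1) / (2 * s) by positivity)).trans h
  rw [show (s + 1) / (2 * s) * (s * n) = (s + 1) / 2 * n by field_simp] at h2
  nlinarith

/-- Achievability of the points that satisfy the bounds for all orders with a margin. -/
lemma isAchievable_of_sum_le (A : Type*) [Field A] [Fintype A] {N : ℕ} {M : ℝ}
    (h0 : 0 ≤ δ) (h1 : δ < 1) (hK : 0 < K) (hKN : K ≤ N) (hbK : b ≤ K)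
    (hb : (b : ℝ) = M * K / N) {R : Fin K → ℝ} (hR : ∀ k, 0 ≤ R k) {η : ℝ} (hη : 0 < η)
    (hsum : ∀ π : Equiv.Perm (Fin K), ∑ j : Fin (K - b),
      (((K - (j.val + 1)).choose b : ℝ) / (K.choose b : ℝ)) / (1 - δ ^ (j.val + 1)) *
        R (π (Fin.castLE (Nat.sub_le K b) j)) ≤ 1 - η) :
    IsAchievable A K N (fun _ => M) (fun _ => δ) b R := by
  intro ε hε
  have hch : (0 : ℝ) < K.choose b := by exact_mod_cast Nat.choose_pos hbK
  set w : Fin (K - b) → ℝ := fun j =>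
    (((K - (j.val + 1)).choose b : ℝ) / (K.choose b : ℝ)) / (1 - δ ^ (j.val + 1)) with hw
  have hw0 : ∀ j, 0 ≤ w j := fun j => le_trans (by positivity) (weight_ge h0 h1 hbK j)
  set c := ∑ j, w j with hc
  have hc0 : 0 ≤ c := Finset.sum_nonneg fun j _ => hw0 j
  obtain ⟨L₀, hL₀⟩ := exists_reliable_scheme (δ := δ) (N := N) (M := M) A h0 h1 hK hbK hb one_pos
    (show 0 < η / 4 by positivity) hε
  -- Sub-files of `⌈(R k + θ) * n / K.choose b⌉` packets: the surplus rate `θ` costs at most `η / 2`.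
  set θ := η / (2 * (c + 1)) with hθ
  have hθ0 : 0 < θ := by positivity
  have hθc : θ * c ≤ η / 2 := by
    rw [hθ, div_mul_eq_mul_div, div_le_div_iff₀ (by positivity) two_pos]
    nlinarith
  set n := max (max L₀ 1) ⌈4 * (K.choose b * c) / η⌉₊ with hn
  have hn0 : 0 < n := lt_of_lt_of_le one_pos ((le_max_right L₀ 1).trans (le_max_left _ _))
  have hn0' : (0 : ℝ) < n := by exact_mod_cast hn0
  have hn1 : 4 * (K.choose b * c) / η ≤ n :=
    (Nat.le_ceil _).trans (by exact_mod_cast le_max_right _ _)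
  let g : Fin K → ℕ := fun k => ⌈(R k + θ) * n / K.choose b⌉₊
  let h : Fin N → ℕ := fun i => if hi : i.val < K then g ⟨i.val, hi⟩ else 0
  have hg1 : ∀ k, (R k + θ) * n ≤ K.choose b * g k := fun k => by
    have := Nat.le_ceil ((R k + θ) * n / K.choose b)
    rwa [div_le_iff₀' hch] at this
  have hg2 : ∀ k, K.choose b * (g k : ℝ) ≤ (R k + θ) * n + K.choose b := fun k => by
    have hpos : 0 ≤ (R k + θ) * n / K.choose b :=
      div_nonneg (mul_nonneg (add_nonneg (hR k) hθ0.le) hn0'.le) hch.le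
    have := mul_le_mul_of_nonneg_left (Nat.ceil_lt_add_one hpos).le hch.le
    rwa [mul_add, mul_div_cancel₀ _ hch.ne', mul_one] at this
  obtain ⟨C, hC, hrel⟩ := hL₀ n ((le_max_left L₀ 1).trans (le_max_left _ _)) n g h (by simp)
    fun π => by
      have e1 : ∑ j : Fin (K - b), ((K - (j.val + 1)).choose b : ℝ) / (1 - δ ^ (j.val + 1)) *
          g (π (Fin.castLE (Nat.sub_le K b) j)) ≤ ∑ j : Fin (K - b), (w j *
            R (π (Fin.castLE (Nat.sub_le K b) j)) * n + w j * (θ * n + K.choose b)) := by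
        refine Finset.sum_le_sum fun j _ => ?_
        rw [← weight_mul_choose hbK, mul_assoc]
        refine (mul_le_mul_of_nonneg_left (hg2 _) (hw0 j)).trans (le_of_eq ?_)
        ring
      rw [Finset.sum_add_distrib, ← Finset.sum_mul, ← Finset.sum_mul, ← hc] at e1
      have e2 := mul_le_mul_of_nonneg_right (hsum π) hn0'.le
      rw [div_le_iff₀ hη] at hn1
      have e3 := mul_le_mul_of_nonneg_right hθc hn0'.le
      refine (add_le_add_left e1 _).trans ?_
      linarith
  refine ⟨_, _, n, C, hn0, ⟨Fin.castLE hKN, Fin.castLE_injective hKN, fun k => ?_⟩, hC, hrel,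
    fun k => ?_⟩
  · simp [h]
  · rw [lt_div_iff₀ hn0', Nat.cast_mul]
    refine lt_of_lt_of_le ?_ (hg1 k)
    exact mul_lt_mul_of_pos_right (by linarith) hn0'

/-- The converse part of the delivery time. -/
lemma exists_error_deliveryTimes_ge (A : Type*) [Field A] [Fintype A] {N : ℕ} (M : Fin K → ℝ)
    (h0 : 0 ≤ δ) (h1 : δ < 1) (hKN : K ≤ N) (hbK : b ≤ K) {η : ℝ} (hη : 0 < η) :
    ∃ ε₀ : ℝ, 0 < ε₀ ∧ ∀ ε F T, ε < ε₀ → 0 < F → T ∈ deliveryTimes A K N M (fun _ => δ) b F ε →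
      F * ∑ j : Fin (K - b),
        (((K - (j.val + 1)).choose b : ℝ) / (K.choose b : ℝ)) / (1 - δ ^ (j.val + 1)) - η * F ≤
          T := by
  set s := ∑ j : Fin (K - b),
    (((K - (j.val + 1)).choose b : ℝ) / (K.choose b : ℝ)) / (1 - δ ^ (j.val + 1)) with hs
  have hs0 : 0 ≤ s := Finset.sum_nonneg fun j _ => le_trans (by positivity)
    (weight_ge h0 h1 hbK j)
  obtain ⟨ε₀, hε₀, hlow⟩ := exists_error_slots_lower_bound A N M h0 h1 hbK
    (show 0 < η / (s + 1) by positivity)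
  refine ⟨ε₀, hε₀, fun ε F T hε hF hT => ?_⟩
  obtain ⟨C, hC, hrel⟩ := hT
  have h := hlow _ T C hC (Fin.castLE hKN) (Fin.castLE_injective hKN) (fun _ => hF)
    (fun k => (hrel _ (Fin.castLE_injective hKN) (fun _ => rfl) k).le.trans hε.le) 1
  rw [← Finset.sum_mul, ← hs] at h
  refine le_trans ?_ h
  have hle : η / (s + 1) * s ≤ η := by
    rw [div_mul_eq_mul_div, div_le_iff₀ (by positivity)]
    nlinarith
  have := mul_le_mul_of_nonneg_right hle (Nat.cast_nonneg (α := ℝ) F)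
  linarith

/-- The achievability part of the delivery time. -/
lemma exists_mem_deliveryTimes_le (A : Type*) [Field A] [Fintype A] {N : ℕ} {M : ℝ}
    (h0 : 0 ≤ δ) (h1 : δ < 1) (hK : 0 < K) (hbK : b ≤ K) (hb : (b : ℝ) = M * K / N) {η ε : ℝ}
    (hη : 0 < η) (hε : 0 < ε) :
    ∃ F₀ : ℕ, ∀ F, F₀ ≤ F → K.choose b ∣ F →
      ∃ n ∈ deliveryTimes A K N (fun _ => M) (fun _ => δ) b F ε, (n : ℝ) ≤ F * ∑ j : Fin (K - b),
        (((K - (j.val + 1)).choose b : ℝ) / (K.choose b : ℝ)) / (1 - δ ^ (j.val + 1)) +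
          η * F := by
  have hch : (0 : ℝ) < K.choose b := by exact_mod_cast Nat.choose_pos hbK
  set s := ∑ j : Fin (K - b),
    (((K - (j.val + 1)).choose b : ℝ) / (K.choose b : ℝ)) / (1 - δ ^ (j.val + 1)) with hs
  have hs0 : 0 ≤ s := Finset.sum_nonneg fun j _ => le_trans (by positivity)
    (weight_ge h0 h1 hbK j)
  obtain ⟨L₀, hL₀⟩ := exists_reliable_scheme (δ := δ) (N := N) (M := M) A h0 h1 hK hbK hb
    (show 0 < (s + η) * K.choose b by positivity) (show 0 < η / 2 * K.choose b by positivity) hε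
  refine ⟨max (K.choose b * L₀) ⌈2 / η⌉₊, fun F hF hdvd => ?_⟩
  obtain ⟨L, rfl⟩ := hdvd
  have hL : L₀ ≤ L := Nat.le_of_mul_le_mul_left ((le_max_left _ _).trans hF)
    (Nat.choose_pos hbK)
  have hF2 : 2 / η ≤ (K.choose b * L : ℕ) :=
    (Nat.le_ceil _).trans (by exact_mod_cast (le_max_right _ _).trans hF)
  rw [div_le_iff₀ hη, Nat.cast_mul] at hF2
  have hceil := Nat.le_ceil ((s + η / 2) * (K.choose b * L))
  have hceil' := Nat.ceil_lt_add_one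
    (show 0 ≤ (s + η / 2) * ((K.choose b : ℝ) * L) by positivity)
  set n := ⌈(s + η / 2) * ((K.choose b : ℝ) * L)⌉₊ with hn
  obtain ⟨C, hC, hrel⟩ := hL₀ L hL n (fun _ => L) (fun _ => L) (by linarith) fun π => by
    have e : ∑ j : Fin (K - b), ((K - (j.val + 1)).choose b : ℝ) / (1 - δ ^ (j.val + 1)) *
        (L : ℝ) = s * (K.choose b * L) := by
      rw [hs, Finset.sum_mul]
      refine Finset.sum_congr rfl fun j _ => ?_
      rw [← mul_assoc, weight_mul_choose hbK]
    rw [e]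
    linarith
  refine ⟨n, ⟨C, hC, hrel⟩, ?_⟩
  push_cast
  linarith

end Region

theorem theorem4 (A : Type*) [Field A] [Fintype A] (K N b : ℕ) (M δ : ℝ)
    (hK : 0 < K) (hKN : K ≤ N) (hM0 : 0 ≤ M) (hMN : M ≤ N) (hb : (b : ℝ) = M * K / N)
    (hδ0 : 0 ≤ δ) (hδ1 : δ < 1) :
    (rateRegion A K N (fun _ => M) (fun _ => δ) b =
      {R : Fin K → ℝ | (∀ k, 0 ≤ R k) ∧ ∀ π : Equiv.Perm (Fin K),
        ∑ j : Fin (K - b),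
          (((K - (j.val + 1)).choose b : ℝ) / (K.choose b : ℝ)) / (1 - δ ^ (j.val + 1)) *
            R (π (Fin.castLE (Nat.sub_le K b) j)) ≤ 1}) ∧
    (∀ η : ℝ, 0 < η → ∃ ε₀ : ℝ, 0 < ε₀ ∧ ∀ ε : ℝ, 0 < ε → ε < ε₀ →
      ∃ F₀ : ℕ, ∀ F : ℕ, F₀ ≤ F → K.choose b ∣ F →
        ∃ T : ℕ, IsLeast (deliveryTimes A K N (fun _ => M) (fun _ => δ) b F ε) T ∧
          |(T : ℝ) - F * ∑ j : Fin (K - b),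
            (((K - (j.val + 1)).choose b : ℝ) / (K.choose b : ℝ)) / (1 - δ ^ (j.val + 1))| ≤
              η * F) := by
  have hbK : b ≤ K := by
    have hN : (0 : ℝ) < N := by exact_mod_cast hK.trans_le hKN
    have : (b : ℝ) ≤ K := by
      rw [hb, div_le_iff₀ hN, mul_comm (K : ℝ)]
      exact mul_le_mul_of_nonneg_right hMN (Nat.cast_nonneg K)
    exact_mod_cast this
  refine ⟨Set.Subset.antisymm (closure_minimal (fun R hR => ⟨hR.1, fun π =>
    sum_le_one_of_isAchievable A hδ0 hδ1 hbK hR.1 hR.2 π⟩) ?_) fun R hR => ?_, fun η hη => ?_⟩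
  · simp only [Set.ofPred_and, Set.ofPred_forall]
    exact (isClosed_iInter fun k => isClosed_le continuous_const (continuous_apply k)).inter
      (isClosed_iInter fun π => isClosed_le (by fun_prop) continuous_const)
  · have hlim : Filter.Tendsto (fun m : ℕ => (1 - 1 / ((m : ℝ) + 1)) • R) Filter.atTop
        (nhds ((1 - 0 : ℝ) • R)) :=
      (tendsto_const_nhds.sub tendsto_one_div_add_atTop_nhds_zero_nat).smul_const R
    rw [sub_zero, one_smul] at hlim
    refine mem_closure_of_tendsto hlim (Filter.Eventually.of_forall fun m => ?_)
    have hm : 0 < 1 / ((m : ℝ) + 1) := by positivity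
    have hm1 : 0 ≤ 1 - 1 / ((m : ℝ) + 1) := by
      rw [sub_nonneg, div_le_one (by positivity)]
      linarith [Nat.cast_nonneg (α := ℝ) m]
    have hnn : ∀ k, 0 ≤ ((1 - 1 / ((m : ℝ) + 1)) • R) k := fun k => mul_nonneg hm1 (hR.1 k)
    refine ⟨hnn, isAchievable_of_sum_le A hδ0 hδ1 hK hKN hbK hb hnn hm fun π => ?_⟩
    refine le_trans (le_of_eq ?_) (mul_le_of_le_one_right hm1 (hR.2 π))
    rw [Finset.mul_sum]
    refine Finset.sum_congr rfl fun j _ => ?_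
    rw [Pi.smul_apply, smul_eq_mul]
    ring
  · obtain ⟨ε₀, hε₀, hge⟩ := exists_error_deliveryTimes_ge (b := b) A (fun _ : Fin K => M) hδ0 hδ1 hKN
      hbK hη
    refine ⟨ε₀, hε₀, fun ε hε hεε => ?_⟩
    obtain ⟨F₀, hF₀⟩ := exists_mem_deliveryTimes_le (N := N) (M := M) A hδ0 hδ1 hK hbK hb hη hε
    refine ⟨max F₀ 1, fun F hF hdvd => ?_⟩
    obtain ⟨n, hn, hnle⟩ := hF₀ F ((le_max_left _ _).trans hF) hdvd
    have hmem := Nat.sInf_mem ⟨n, hn⟩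
    refine ⟨_, ⟨hmem, fun m hm => Nat.sInf_le hm⟩, abs_sub_le_iff.2 ⟨?_, ?_⟩⟩
    · have : ((sInf (deliveryTimes A K N (fun _ => M) (fun _ => δ) b F ε) : ℕ) : ℝ) ≤ n := by
        exact_mod_cast Nat.sInf_le hn
      linarith
    · linarith [hge ε F _ hεε ((le_max_right F₀ 1).trans hF) hmem]
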